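/- Let $n\ge 1$, $\sigma_W>0$, let $\Sigma_X\in\mathbb{R}^{n\times n}$ be positive definite with eigenvalues $\lambda_1,\dots,\lambda_n$, and let $\Sigma_X=LL^\top$ with $L=(\ell_{ij})$ real lower triangular (Cholesky factor). All rates are in bits ($\log=\log_2$). **Model.** For $a\ge 1$ let $W\in\mathbb{R}^{a\times n}$ have i.i.d. $\mathcal N(0,\sigma_W^2)$ entries. For spacings $\alpha_1,\dots,\alpha_n>0$ the ZSIC algorithm starts with $Y=WL$ and, for $i=n,n-1,\dots,1$, sets $Z_{:,i}=\mathrm{round}(Y_{:,i}/(\alpha_i\ell_{ii}))$ (with $\mathrm{round}(x)=\lfloor x+\tfrac12\rfloor$) and replaces $Y$ by $Y-\alpha_iZ_{:,i}L_{i,:}$. The reconstruction is $\hat W=Z\,\mathrm{diag}(\alpha_1,\dots,\alpha_n)$, and the distortion is $\frac1{na}\mathbb{E}\,\mathrm{tr}\,(W-\hat W)\Sigma_X(W-\hat W)^\top$. Each column $Z_{:,i}\in\mathbb{Z}^a$ is entropy coded, as one block, by an optimal prefix-free binary code for its law (a Huffman code); the rate is $\frac1{na}$ times the sum over the $n$ columns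 of the expected codeword lengths (the description of the $n$ spacings is not counted). Huffman-GPTQ uses $\alpha_i=\alpha$ for all $i$, and (Plain)WaterSIC uses $\alpha_i=\alpha\,|\det L|^{1/n}/|\ell_{ii}|$, with $\alpha>0$ a free parameter. $R^{(a)}_{\mathrm{GPTQ}}(D,\Sigma_X)$ and $R^{(a)}_{\mathrm{WaterSIC}}(D,\Sigma_X)$ denote the infimum, over all $\alpha>0$ for which the distortion is at most $D$, of the rate of the respective scheme with $a$ rows. The waterfilling rate is $$R_{\mathrm{WF}}(D,\Sigma_X)=\frac1n\sum_{i=1}^n\frac12\log\max\Big\{1,\frac{\sigma_W^2\lambda_i}{\tau}\Big\},\qquad D=\frac1n\sum_{i=1}^n\min\{\sigma_W^2\lambda_i,\tau\}.$$ **Theorem.** We have $$\lim_{a\to\infty}\lim_{D\to0}\big[R^{(a)}_{\mathrm{GPTQ}}(D,\Sigma_X)-R_{\mathrm{WF}}(D,\Sigma_X)\big]=\frac12\log\frac{2\pi e}{12}+\frac12\log\frac{\frac1n\sum_{i=1}^n\ell_{ii}^2}{\big(\prod_{i=1}^n\ell_{ii}^2\big)^{1/n}}$$ and $$\lim_{a\to\infty}\lim_{D\to0}\big[R^{(a)}_{\mathrm{WaterSIC}}(D,\Sigma_X)-R_{\mathrm{WF}}(D,\Sigma_X)\big]=\frac12\log\frac{2\pi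 e}{12}\approx0.255 .$$ Here the iterated limit means that both $\limsup_{D\to0^+}$ and $\liminf_{D\to0^+}$ of the bracket, taken for fixed $a$, converge to the stated value as $a\to\infty$; and $\approx 0.255$ means within $0.0005$. -/

import Mathlib

open Filter Topology MeasureTheory ProbabilityTheory
open scoped ENNReal NNReal Matrix

noncomputable section

namespace WeightQuant

variable {a n : ℕ}

/-- One pass of the loop of the ZSIC algorithm, for the column `i`. The state is the pair of the
current `Y` and the current `Z`. The `i`-th column of `Z` becomes
`round (Y_{:,i} / (α_i ℓ_{ii}))`, with `round x = ⌊x + 1/2⌋`, and then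
`Y ← Y - α_i Z_{:,i} L_{i,:}`. -/
def zsicStep (L : Matrix (Fin n) (Fin n) ℝ) (α : Fin n → ℝ)
    (s : Matrix (Fin a) (Fin n) ℝ × Matrix (Fin a) (Fin n) ℤ) (i : Fin n) :
    Matrix (Fin a) (Fin n) ℝ × Matrix (Fin a) (Fin n) ℤ :=
  let z : Fin a → ℤ := fun r => round (s.1 r i / (α i * L i i))
  (s.1 - Matrix.of (fun r j => α i * (z r : ℝ) * L i j), s.2.updateCol i z)

/-- The ZSIC algorithm with input `Y`, lower triangular matrix `L` and spacings `α`: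
start from `Z = 0` and treat the columns in the order `n, n - 1, …, 1`. -/
def zsic (Y : Matrix (Fin a) (Fin n) ℝ) (L : Matrix (Fin n) (Fin n) ℝ) (α : Fin n → ℝ) :
    Matrix (Fin a) (Fin n) ℤ :=
  ((List.finRange n).reverse.foldl (zsicStep L α) (Y, 0)).2

/-- The integer matrix that represents the weight matrix `W`, that is, ZSIC applied to `Y = W L`. -/
def quantIdx (L : Matrix (Fin n) (Fin n) ℝ) (α : Fin n → ℝ) (W : Matrix (Fin a) (Fin n) ℝ) :
    Matrix (Fin a) (Fin n) ℤ :=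
  zsic (W * L) L α

/-- The reconstruction `Ŵ = Z diag(α_1, …, α_n)`. -/
def reconstruct (α : Fin n → ℝ) (Z : Matrix (Fin a) (Fin n) ℤ) : Matrix (Fin a) (Fin n) ℝ :=
  Z.map (fun z : ℤ => (z : ℝ)) * Matrix.diagonal α

/-- The law of an `a × n` matrix whose entries are independent `N(0, σ²)`. -/
def weightLaw (a n : ℕ) (σ : ℝ≥0) : Measure (Fin a → Fin n → ℝ) :=
  Measure.pi fun _ => Measure.pi fun _ => gaussianReal 0 (σ ^ 2)

/-- The distortion `D = (1 / (n a)) E tr (W - Ŵ) Σ_X (W - Ŵ)ᵀ` for `Σ_X = S`. -/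
def distortion (a : ℕ) (σ : ℝ≥0) (S L : Matrix (Fin n) (Fin n) ℝ) (α : Fin n → ℝ) : ℝ≥0∞ :=
  (∫⁻ w, ENNReal.ofReal
      (let W : Matrix (Fin a) (Fin n) ℝ := Matrix.of w
       let E := W - reconstruct α (quantIdx L α W)
       (E * S * Eᵀ).trace) ∂(weightLaw a n σ)) / ((n : ℝ≥0∞) * (a : ℝ≥0∞))

/-- A binary code is prefix-free if no codeword is a prefix of the codeword of another symbol. -/
def IsPrefixFree {A : Type*} (c : A → List Bool) : Prop :=
  ∀ x y, x ≠ y → ¬ (c x <+: c y)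

/-- The expected number of bits that an optimal prefix-free binary code (a Huffman code) spends on
the random symbol `X`. The code may depend on the law of `X`. -/
def entropyCodedLength {Ω A : Type*} [MeasurableSpace Ω] (P : Measure Ω) (X : Ω → A) : ℝ≥0∞ :=
  ⨅ (c : A → List Bool) (_ : IsPrefixFree c), ∫⁻ ω, ((c (X ω)).length : ℝ≥0∞) ∂P

/-- The rate in bits per weight: each column of the ZSIC output, a vector in `ℤ^a`, is entropy
coded on its own, and the expected lengths are added and divided by `n a`. -/
def rate (a : ℕ) (σ : ℝ≥0) (L : Matrix (Fin n) (Fin n) ℝ) (α : Fin n → ℝ) : ℝ≥0∞ :=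
  (∑ i : Fin n, entropyCodedLength (weightLaw a n σ)
      (fun w => fun r : Fin a => quantIdx L α (Matrix.of w) r i)) / ((n : ℝ≥0∞) * (a : ℝ≥0∞))

/-- The rate-distortion function of ZSIC with entropy coding, for a one-parameter family
`spacing α`, `α > 0`, of spacings: the least rate at which the distortion is at most `D`. -/
def rateAt (a : ℕ) (σ : ℝ≥0) (S L : Matrix (Fin n) (Fin n) ℝ) (spacing : ℝ → Fin n → ℝ)
    (D : ℝ) : ℝ≥0∞ :=
  ⨅ (α : ℝ) (_ : 0 < α) (_ : distortion a σ S L (spacing α) ≤ ENNReal.ofReal D),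
    rate a σ L (spacing α)

/-- GPTQ: all spacings are equal. -/
def gptqSpacing (n : ℕ) (α : ℝ) : Fin n → ℝ := fun _ => α

/-- PlainWaterSIC: `α_i = α |det L|^{1/n} / |ℓ_{ii}|`. -/
def waterSICSpacing (L : Matrix (Fin n) (Fin n) ℝ) (α : ℝ) : Fin n → ℝ :=
  fun i => α * (|L.det| ^ (1 / (n : ℝ)) / |L i i|)

/-- `R_GPTQ(D, Σ_X)`, the rate of Huffman-GPTQ on `a` rows. -/
def rateGPTQ (a : ℕ) (σ : ℝ≥0) (S L : Matrix (Fin n) (Fin n) ℝ) (D : ℝ) : ℝ≥0∞ :=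
  rateAt a σ S L (gptqSpacing n) D

/-- `R_WaterSIC(D, Σ_X)`, the rate of PlainWaterSIC on `a` rows. -/
def rateWaterSIC (a : ℕ) (σ : ℝ≥0) (S L : Matrix (Fin n) (Fin n) ℝ) (D : ℝ) : ℝ≥0∞ :=
  rateAt a σ S L (waterSICSpacing L) D

/-- The water level: the `τ > 0` with `D = (1/n) ∑ min (σ² λ_i, τ)`, where the `λ_i` are the
eigenvalues of `S`. It exists for `0 < D ≤ (1/n) ∑ σ² λ_i` and `S` positive definite; the least
one is taken at the right end point, where it is not unique. -/
def waterLevel (σ : ℝ≥0) {S : Matrix (Fin n) (Fin n) ℝ} (hS : S.IsHermitian) (D : ℝ) : ℝ :=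
  sInf {τ : ℝ | 0 < τ ∧ D = (1 / (n : ℝ)) * ∑ i, min ((σ : ℝ) ^ 2 * hS.eigenvalues i) τ}

/-- The waterfilling rate `R_WF(D, Σ_X) = (1/n) ∑ ½ log₂ max (1, σ² λ_i / τ)`. -/
def rateWF (σ : ℝ≥0) {S : Matrix (Fin n) (Fin n) ℝ} (hS : S.IsHermitian) (D : ℝ) : ℝ :=
  (1 / (n : ℝ)) * ∑ i, (1 / 2) *
    Real.logb 2 (max 1 ((σ : ℝ) ^ 2 * hS.eigenvalues i / waterLevel σ hS D))

/-- `lim_{a → ∞} lim_{D → 0+} g a D = c`. As code lengths are integers, the inner limit need not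
exist for a fixed `a`; the iterated limit is understood as: the inner upper limit and the inner
lower limit both tend to `c` as `a → ∞`. -/
def HasIteratedLimit (g : ℕ → ℝ → EReal) (c : EReal) : Prop :=
  Tendsto (fun a => limsup (g a) (𝓝[>] (0 : ℝ))) atTop (𝓝 c) ∧
  Tendsto (fun a => liminf (g a) (𝓝[>] (0 : ℝ))) atTop (𝓝 c)

end WeightQuant

end

noncomputable section

namespace WeightQuant

/-! ### Prefix-free codes -/

/-! Multiplied by `L`, the error in column `i` of a row becomes `α_i ℓ_ii` times the rounding error
of `x_i / α_i` plus an offset, and the offset depends only on the columns after `i`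
(`sum_error_mul`, `feedback_update`). With the other coordinates frozen, column `i` is therefore a
scalar uniform quantizer with a fixed offset, applied to a Gaussian.

Distortion: a Gaussian is nearly flat at the scale of a small step, so the mean squared rounding
error tends to `1/12` uniformly in the offset (`abs_integral_roundErrSq_sub_le`). For spacings `α
b_i` this gives `D ≈ α² · meanSq L b / 12`.

Rate: a column costs about `h - log₂ α_i` bits per entry, where `h` is the differential entropy of
`N(0, σ²)`. The converse `le_entropyCodedLength_column` holds for all spacings: Kraft's inequality
is combined with the fact that each quantization cell, at frozen other coordinates, has length
`α_i`. For achievability, `entropyCodedLength_column_le` uses a code built for i.i.d. rounded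
Gaussians without feedback. The mismatch vanishes with the spacings because the quantization error
is uniformly bounded by a multiple of them, and the coding overhead of 2 bits is shared by `a` rows.

Waterfilling: for small `D` the water level is `D`, and `∏ λ_i = det S = ∏ ℓ_ii²`, so the rate is
explicit (`eventually_rateWF_eq`). Eliminating `α` leaves `½ log₂ (2πe/12)` plus half the log-ratio
of the arithmetic to the geometric mean of `(b_i ℓ_ii)²`. GPTQ has `b_i = 1`; WaterSIC makes all
`b_i |ℓ_ii|` equal, so the two means agree. -/

theorem IsPrefixFree.injective {A : Type*} {c : A → List Bool} (hc : IsPrefixFree c) :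
    Function.Injective c := by
  intro x y hxy
  by_contra h
  exact hc x y h (hxy ▸ List.prefix_rfl)

/-- Two factorizations of one string start with comparable codewords, which must coincide and can be
cancelled. An empty codeword would break this, as it can be repeated freely. -/
theorem IsPrefixFree.uniquelyDecodable {A : Type*} {c : A → List Bool} (hc : IsPrefixFree c)
    (hne : ∀ x, c x ≠ []) : InformationTheory.UniquelyDecodable (Set.range c) := by
  intro u
  induction u with
  | nil =>
    intro v _ hv h
    cases v with
    | nil => rfl
    | cons b v =>
      obtain ⟨x, rfl⟩ := hv b (by simp)
      simp at h
      exact absurd h.1 (hne x)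
  | cons b u ih =>
    intro v hu hv h
    obtain ⟨x, rfl⟩ := hu b (by simp)
    cases v with
    | nil =>
      simp at h
      exact absurd h.1 (hne x)
    | cons d v =>
      obtain ⟨y, rfl⟩ := hv d (by simp)
      simp only [List.flatten_cons] at h
      have hxy : x = y := by
        by_contra hxy
        have h1 : c x <+: c y ++ v.flatten := h ▸ List.prefix_append _ _
        rcases List.prefix_or_prefix_of_prefix h1 (List.prefix_append _ _) with h2 | h2
        · exact hc x y hxy h2
        · exact hc y x (Ne.symm hxy) h2
      subst hxy
      rw [ih v (fun w hw => hu w (by simp [hw])) (fun w hw => hv w (by simp [hw]))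
        (List.append_cancel_left h)]

/-- Kraft's inequality for a prefix-free code. -/
theorem IsPrefixFree.kraft {A : Type*} {c : A → List Bool} (hc : IsPrefixFree c) :
    ∑' x, (2⁻¹ : ℝ≥0∞) ^ (c x).length ≤ 1 := by
  classical
  by_cases hne : ∀ x, c x ≠ []
  · refine ENNReal.summable.tsum_le_of_sum_le fun s => ?_
    have hud : InformationTheory.UniquelyDecodable
        ((s.image c : Finset (List Bool)) : Set (List Bool)) := by
      intro u v hu hv h
      exact hc.uniquelyDecodable hne u v
        (fun w hw => by have := hu w hw; simp at this; obtain ⟨x, -, rfl⟩ := this; simp)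
        (fun w hw => by have := hv w hw; simp at this; obtain ⟨x, -, rfl⟩ := this; simp) h
    have h := InformationTheory.kraft_mcmillan_inequality hud
    rw [Finset.sum_image (hc.injective.injOn)] at h
    have h2 := ENNReal.ofReal_le_ofReal h
    rw [ENNReal.ofReal_sum_of_nonneg (fun _ _ => by positivity), ENNReal.ofReal_one] at h2
    refine le_trans (le_of_eq (Finset.sum_congr rfl fun x _ => ?_)) h2
    rw [ENNReal.ofReal_pow (by positivity)]
    congr 1
    simp [ENNReal.ofReal_inv_of_pos]
  -- An empty codeword is a prefix of every other one, so the alphabet has a single symbol and the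
  -- Kraft sum is 1.
  · push Not at hne
    obtain ⟨x, hx⟩ := hne
    have hall : ∀ y, y = x := by
      intro y
      by_contra h
      exact hc x y (Ne.symm h) (by simp [hx])
    rw [tsum_eq_single x (fun y hy => absurd (hall y) hy)]
    simp [hx]

/-- The binary expansion of `m` with `l` digits, most significant digit first. -/
def binaryWord : ℕ → ℕ → List Bool
  | 0, _ => []
  | l + 1, m => binaryWord l (m / 2) ++ [m.bodd]

theorem length_binaryWord (l m : ℕ) : (binaryWord l m).length = l := by
  induction l generalizing m with
  | zero => rfl
  | succ l ih => simp [binaryWord, ih]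

theorem binaryWord_inj {l m m' : ℕ} (hm : m < 2 ^ l) (hm' : m' < 2 ^ l)
    (h : binaryWord l m = binaryWord l m') : m = m' := by
  induction l generalizing m m' with
  | zero => simp at hm hm'; omega
  | succ l ih =>
    simp only [binaryWord] at h
    obtain ⟨h1, h2⟩ := List.append_inj h (by simp [length_binaryWord])
    have h3 := ih (by rw [pow_succ] at hm; omega) (by rw [pow_succ] at hm'; omega) h1
    simp only [List.cons.injEq, and_true] at h2
    have h4 := Nat.bodd_add_div2 m
    have h5 := Nat.bodd_add_div2 m'
    rw [Nat.div2_val] at h4 h5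
    rw [← h4, ← h5, h2, h3]

theorem take_binaryWord (l k m : ℕ) :
    (binaryWord (l + k) m).take l = binaryWord l (m / 2 ^ k) := by
  induction k generalizing m with
  | zero => simp [List.take_of_length_le, length_binaryWord]
  | succ k ih =>
    rw [← add_assoc, binaryWord, List.take_append_of_le_length (by simp [length_binaryWord]), ih,
      Nat.div_div_eq_div_mul, pow_succ, mul_comm]

/-- Read `m` with `l` digits as the dyadic cell `[m/2^l, (m+1)/2^l)`: being a prefix means that the
cell of `m` contains the cell of `m'`. -/
theorem eq_div_of_binaryWord_prefix {l l' m m' : ℕ} (hm : m < 2 ^ l) (hm' : m' < 2 ^ l')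
    (h : binaryWord l m <+: binaryWord l' m') : l ≤ l' ∧ m = m' / 2 ^ (l' - l) := by
  have hl : l ≤ l' := by simpa [length_binaryWord] using h.length_le
  obtain ⟨k, rfl⟩ := Nat.exists_eq_add_of_le hl
  refine ⟨hl, ?_⟩
  rw [List.prefix_iff_eq_take, length_binaryWord, take_binaryWord] at h
  rw [Nat.add_sub_cancel_left]
  exact binaryWord_inj hm (by rw [pow_add] at hm'; exact Nat.div_lt_of_lt_mul (by linarith)) h

/-- Shannon–Fano–Elias coding: a sub-probability vector `q` on a countable alphabet is matched by a
prefix-free code whose codeword for `x` has at most `2 - log₂ (q x)` bits. -/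
theorem exists_isPrefixFree_length_le {A : Type*} [Countable A] (q : A → ℝ) (hq : ∀ x, 0 < q x)
    (hs : Summable q) (hs1 : ∑' x, q x ≤ 1) :
    ∃ c : A → List Bool, IsPrefixFree c ∧ ∀ x, ((c x).length : ℝ) ≤ 2 - Real.logb 2 (q x) := by
  classical
  obtain ⟨e, he⟩ := exists_injective_nat A
  -- `T` is the cumulative distribution in the enumeration `e`; the intervals `[T x, T x + q x)` are
  -- disjoint in `[0, 1]`.
  set T : A → ℝ := fun x => ∑' y, if e y < e x then q y else 0 with hT
  have hsum : ∀ (p : A → Prop) [DecidablePred p], Summable fun y => if p y then q y else 0 :=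
    fun p _ =>
    hs.of_nonneg_of_le (fun y => by split_ifs <;> simp [(hq y).le])
      (fun y => by split_ifs <;> simp [(hq y).le])
  have hT0 : ∀ x, 0 ≤ T x := fun x => tsum_nonneg fun y => by split_ifs <;> simp [(hq y).le]
  have hTadd : ∀ x, T x + q x = ∑' y, if e y ≤ e x then q y else 0 := by
    intro x
    have h1 : q x = ∑' y, if y = x then q y else 0 := by simp
    conv_lhs => rw [h1]
    simp only [hT]
    rw [← (hsum fun y => e y < e x).tsum_add (hsum fun y => y = x)]
    refine tsum_congr fun y => ?_
    by_cases hyx : y = x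
    · subst hyx; simp
    · have : e y ≠ e x := fun h => hyx (he h)
      simp only [hyx, if_false, add_zero]
      congr 1
      exact propext ⟨le_of_lt, fun h => lt_of_le_of_ne h this⟩
  have hT1 : ∀ x, T x + q x ≤ 1 := by
    intro x
    rw [hTadd]
    exact le_trans ((hsum fun y => e y ≤ e x).tsum_le_tsum
      (fun y => by split_ifs <;> simp [(hq y).le]) hs) hs1
  have hTlt : ∀ x y, e x < e y → T x + q x ≤ T y := by
    intro x y hxy
    rw [hTadd]
    refine (hsum fun z => e z ≤ e x).tsum_le_tsum (fun z => ?_) (hsum fun z => e z < e y)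
    by_cases h : e z ≤ e x
    · simp [h, h.trans_lt hxy]
    · simp only [h, if_false]; split_ifs <;> simp [(hq z).le]
  have hq1 : ∀ x, q x ≤ 1 := fun x => by linarith [hT1 x, hT0 x]
  -- The extra digit makes `q x` at least two cell widths, so that a whole dyadic cell of level `l
  -- x`, the one with index `m x`, fits in `[T x, T x + q x)`.
  set l : A → ℕ := fun x => ⌈-Real.logb 2 (q x)⌉₊ + 1 with hl
  set m : A → ℕ := fun x => ⌈T x * 2 ^ l x⌉₊ with hm
  have hlog : ∀ x, 0 ≤ -Real.logb 2 (q x) := fun x =>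
    neg_nonneg.2 (Real.logb_nonpos (by norm_num) (hq x).le (hq1 x))
  have hlq : ∀ x, 2 ≤ q x * 2 ^ l x := by
    intro x
    have h1 : -Real.logb 2 (q x) ≤ ⌈-Real.logb 2 (q x)⌉₊ := Nat.le_ceil _
    have h2 : (q x)⁻¹ ≤ 2 ^ ⌈-Real.logb 2 (q x)⌉₊ := by
      have := (Real.logb_le_iff_le_rpow (by norm_num) (inv_pos.2 (hq x))).1
        ((Real.logb_inv 2 (q x)).trans_le h1)
      rwa [Real.rpow_natCast] at this
    have h3 : 1 ≤ q x * 2 ^ ⌈-Real.logb 2 (q x)⌉₊ := by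
      have := mul_le_mul_of_nonneg_left h2 (hq x).le
      rwa [mul_inv_cancel₀ (hq x).ne'] at this
    simp only [hl, pow_succ]
    linarith
  have hml : ∀ x, T x * 2 ^ l x ≤ m x := fun x => Nat.le_ceil _
  have hmu : ∀ x, (m x : ℝ) + 1 ≤ (T x + q x) * 2 ^ l x := by
    intro x
    have h1 := Nat.ceil_lt_add_one (mul_nonneg (hT0 x) (by positivity : (0 : ℝ) ≤ 2 ^ l x))
    have h2 := hlq x
    have h3 : (m x : ℝ) = (⌈T x * 2 ^ l x⌉₊ : ℝ) := rfl
    nlinarith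
  have hmlt : ∀ x, m x < 2 ^ l x := by
    intro x
    have h1 := hmu x
    have h2 : (T x + q x) * 2 ^ l x ≤ 1 * 2 ^ l x := by
      gcongr; exact hT1 x
    have h3 : (m x : ℝ) < 2 ^ l x := by linarith
    exact_mod_cast h3
  refine ⟨fun x => binaryWord (l x) (m x), ?_, ?_⟩
  -- A prefix relation would nest the cell of `y` in the cell of `x`, while the two cells lie in
  -- disjoint intervals.
  · intro x y hxy hpre
    obtain ⟨hll, hdiv⟩ := eq_div_of_binaryWord_prefix (hmlt x) (hmlt y) hpre
    obtain ⟨k, hk⟩ := Nat.exists_eq_add_of_le hll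
    rw [hk, Nat.add_sub_cancel_left] at hdiv
    have hA : m x * 2 ^ k ≤ m y := by rw [hdiv]; exact Nat.div_mul_le_self _ _
    have hB : m y + 1 ≤ (m x + 1) * 2 ^ k := by
      rw [hdiv, mul_comm]; exact Nat.lt_mul_div_succ _ (by positivity)
    have hA' : (m x : ℝ) * 2 ^ k ≤ m y := by exact_mod_cast hA
    have hB' : (m y : ℝ) + 1 ≤ (m x + 1) * 2 ^ k := by exact_mod_cast hB
    have hpow : (2 : ℝ) ^ l y = 2 ^ l x * 2 ^ k := by rw [hk, pow_add]
    have hpy : (0 : ℝ) < 2 ^ l y := by positivity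
    have hpk : (0 : ℝ) < 2 ^ k := by positivity
    have e1 := mul_le_mul_of_nonneg_right (hmu x) hpk.le
    have e2 := mul_le_mul_of_nonneg_right (hml x) hpk.le
    rw [mul_assoc, ← hpow] at e1 e2
    rcases lt_or_gt_of_ne (fun h => hxy (he h)) with h | h
    · have e3 := mul_le_mul_of_nonneg_right (hTlt x y h) hpy.le
      linarith [hml y]
    · have e3 := mul_le_mul_of_nonneg_right (hTlt y x h) hpy.le
      linarith [hmu y]
  · intro x
    have := Nat.ceil_lt_add_one (hlog x)
    simp only [length_binaryWord, hl]
    push_cast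
    linarith

/-! ### Bounds for the length of an optimal prefix-free code -/

/-- `q` need not be the law of `X`. This freedom is essential later, where the code ignores the
feedback. -/
theorem entropyCodedLength_le {Ω A : Type*} [MeasurableSpace Ω] [Countable A] (P : Measure Ω)
    (X : Ω → A) (q : A → ℝ) (hq : ∀ x, 0 < q x) (hs : Summable q) (hs1 : ∑' x, q x ≤ 1) :
    entropyCodedLength P X ≤ ∫⁻ ω, ENNReal.ofReal (2 - Real.logb 2 (q (X ω))) ∂P := by
  obtain ⟨c, hc, hlen⟩ := exists_isPrefixFree_length_le q hq hs hs1
  refine (iInf₂_le c hc).trans (lintegral_mono fun ω => ?_)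
  rw [← ENNReal.ofReal_natCast]
  exact ENNReal.ofReal_le_ofReal (hlen _)

/-- A converse bound in terms of a density: if the reciprocal of `ψ` has integral at most `β` over
each level set of `X`, then a prefix-free code for `X` needs at least `-E log₂ ψ - log₂ β` bits on
average. -/
theorem le_entropyCodedLength {Ω A : Type*} [MeasurableSpace Ω] [Countable A] (P : Measure Ω)
    [IsProbabilityMeasure P] (X : Ω → A) (hX : ∀ z, MeasurableSet (X ⁻¹' {z}))
    (ψ : Ω → ℝ) (hψm : Measurable ψ) (hψ : ∀ ω, 0 < ψ ω)
    (hlog : Integrable (fun ω => Real.logb 2 (ψ ω)) P) (β : ℝ) (hβ : 0 < β)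
    (hle : ∀ z, ∫⁻ ω in X ⁻¹' {z}, ENNReal.ofReal (ψ ω)⁻¹ ∂P ≤ ENNReal.ofReal β) :
    ENNReal.ofReal (-(∫ ω, Real.logb 2 (ψ ω) ∂P) - Real.logb 2 β) ≤ entropyCodedLength P X := by
  refine le_iInf₂ fun c hc => ?_
  by_cases htop : ∫⁻ ω, ((c (X ω)).length : ℝ≥0∞) ∂P = ⊤
  · rw [htop]; exact le_top
  let _ : MeasurableSpace A := ⊤
  have hXm : Measurable X := measurable_to_countable' hX
  have hlm : Measurable fun ω => ((c (X ω)).length : ℝ) :=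
    (measurable_from_top (f := fun z => ((c z).length : ℝ))).comp hXm
  have hcast : ∀ ω, ((c (X ω)).length : ℝ≥0∞) = ENNReal.ofReal ((c (X ω)).length : ℝ) :=
    fun ω => (ENNReal.ofReal_natCast _).symm
  simp only [hcast] at htop ⊢
  have hli : Integrable (fun ω => ((c (X ω)).length : ℝ)) P :=
    (lintegral_ofReal_ne_top_iff_integrable hlm.aestronglyMeasurable
      (ae_of_all _ fun _ => by positivity)).1 htop
  rw [← ofReal_integral_eq_lintegral_ofReal hli (ae_of_all _ fun _ => by positivity)]
  refine ENNReal.ofReal_le_ofReal ?_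
  -- Gibbs' inequality: `r` has integral at most 1 by Kraft and `hle`, and integrating `log r ≤ r -
  -- 1` gives the bound on the mean length.
  set r : Ω → ℝ := fun ω => (2⁻¹ : ℝ) ^ (c (X ω)).length * (ψ ω)⁻¹ * β⁻¹ with hr
  have hr0 : ∀ ω, 0 < r ω := fun ω => by have := hψ ω; positivity
  have hrm : Measurable r :=
    (((measurable_from_top (f := fun z => (2⁻¹ : ℝ) ^ (c z).length)).comp hXm).mul
      hψm.inv).mul_const _
  have hr1 : ∫⁻ ω, ENNReal.ofReal (r ω) ∂P ≤ 1 := by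
    have huniv : ⋃ z, X ⁻¹' {z} = Set.univ := by ext; simp
    have hdisj : Pairwise (Function.onFun Disjoint fun z => X ⁻¹' {z}) := fun x y hxy =>
      Disjoint.preimage _ (by simpa using hxy)
    rw [← setLIntegral_univ, ← huniv, lintegral_iUnion hX hdisj]
    calc ∑' z, ∫⁻ ω in X ⁻¹' {z}, ENNReal.ofReal (r ω) ∂P
        ≤ ∑' z, (2⁻¹ : ℝ≥0∞) ^ (c z).length := by
          refine ENNReal.tsum_le_tsum fun z => ?_
          have h1 : ∫⁻ ω in X ⁻¹' {z}, ENNReal.ofReal (r ω) ∂P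
              = ∫⁻ ω in X ⁻¹' {z}, ENNReal.ofReal ((2⁻¹ : ℝ) ^ (c z).length * β⁻¹) *
                  ENNReal.ofReal (ψ ω)⁻¹ ∂P := by
            refine setLIntegral_congr_fun (hX z) fun ω hω => ?_
            have hω' : X ω = z := hω
            simp only [hr, hω']
            rw [← ENNReal.ofReal_mul (by positivity)]
            congr 1
            ring
          rw [h1, lintegral_const_mul _
            (f := fun ω => ENNReal.ofReal (ψ ω)⁻¹) hψm.inv.ennreal_ofReal]
          calc _ ≤ ENNReal.ofReal ((2⁻¹ : ℝ) ^ (c z).length * β⁻¹) * ENNReal.ofReal β := by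
                gcongr; exact hle z
            _ = ENNReal.ofReal ((2⁻¹ : ℝ) ^ (c z).length) := by
                rw [← ENNReal.ofReal_mul (by positivity)]
                congr 1
                field_simp
            _ = _ := by
                rw [ENNReal.ofReal_pow (by positivity)]
                simp [ENNReal.ofReal_inv_of_pos]
      _ ≤ 1 := hc.kraft
  have hri : Integrable r P :=
    (lintegral_ofReal_ne_top_iff_integrable hrm.aestronglyMeasurable
      (ae_of_all _ fun ω => (hr0 ω).le)).1 (ne_top_of_le_ne_top ENNReal.one_ne_top hr1)
  have hrint : ∫ ω, r ω ∂P ≤ 1 := by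
    rw [← ofReal_integral_eq_lintegral_ofReal hri (ae_of_all _ fun ω => (hr0 ω).le)] at hr1
    simpa using hr1
  have hl2 : 0 < Real.log 2 := Real.log_pos (by norm_num)
  have hpt : ∀ ω, -((c (X ω)).length : ℝ) - Real.logb 2 (ψ ω) - Real.logb 2 β
      ≤ (r ω - 1) / Real.log 2 := by
    intro ω
    have h1 := Real.log_le_sub_one_of_pos (hr0 ω)
    rw [le_div_iff₀ hl2]
    refine le_trans (le_of_eq ?_) h1
    have hψ' := (hψ ω).ne'
    simp only [hr]
    rw [Real.log_mul (by positivity) (by positivity), Real.log_mul (by positivity) (by positivity),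
      Real.log_pow, Real.log_inv, Real.log_inv, Real.log_inv]
    simp only [Real.logb]
    field_simp
    ring
  have hmono := integral_mono (μ := P) ((hli.neg.sub hlog).sub (integrable_const (Real.logb 2 β)))
    ((hri.sub (integrable_const (1 : ℝ))).div_const (Real.log 2)) hpt
  have hl : ∫ ω, (-((c (X ω)).length : ℝ) - Real.logb 2 (ψ ω) - Real.logb 2 β) ∂P
      = -(∫ ω, ((c (X ω)).length : ℝ) ∂P) - (∫ ω, Real.logb 2 (ψ ω) ∂P) - Real.logb 2 β := by
    rw [integral_sub (f := fun ω => -((c (X ω)).length : ℝ) - Real.logb 2 (ψ ω))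
      (hli.neg.sub hlog) (integrable_const _),
      integral_sub (f := fun ω => -((c (X ω)).length : ℝ)) hli.neg hlog, integral_neg]
    simp
  have hr' : ∫ ω, (r ω - 1) / Real.log 2 ∂P = ((∫ ω, r ω ∂P) - 1) / Real.log 2 := by
    rw [integral_div, integral_sub hri (integrable_const _)]
    simp
  have hmono' := (hl.symm.trans_le hmono).trans_eq hr'
  have h0 : (∫ ω, r ω ∂P - 1) / Real.log 2 ≤ 0 := div_nonpos_of_nonpos_of_nonneg (by linarith) hl2.le
  linarith

/-! ### Scalar quantization of a Gaussian random variable -/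

theorem measurable_round_real : Measurable fun x : ℝ => round x := by
  have : (fun x : ℝ => round x) = fun x => ⌊x + 1 / 2⌋ := funext fun x => round_eq x
  rw [this]
  exact Int.measurable_floor.comp (measurable_id.add_const _)

/-- The squared error of rounding to the nearest integer. -/
def roundErrSq (t : ℝ) : ℝ := (t - round t) ^ 2

theorem measurable_roundErrSq : Measurable roundErrSq :=
  (measurable_id.sub ((measurable_from_top (f := fun z : ℤ => (z : ℝ))).comp
    measurable_round_real)).pow_const 2

theorem roundErrSq_nonneg (t : ℝ) : 0 ≤ roundErrSq t := sq_nonneg _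

theorem roundErrSq_le (t : ℝ) : roundErrSq t ≤ 1 / 4 := by
  have h := abs_le.1 (abs_sub_round t)
  unfold roundErrSq
  nlinarith [h.1, h.2]

theorem roundErrSq_periodic : Function.Periodic roundErrSq 1 := by
  intro t
  simp [roundErrSq, round_add_one]

theorem integral_roundErrSq_add (y : ℝ) : ∫ w in (0 : ℝ)..1, roundErrSq (y + w) = 1 / 12 := by
  rw [intervalIntegral.integral_comp_add_left (fun t => roundErrSq t) y, add_zero,
    roundErrSq_periodic.intervalIntegral_add_eq y (-(1 / 2))]
  have h : ∫ t in (-(1 / 2) : ℝ)..(-(1 / 2) + 1), roundErrSq t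
      = ∫ t in (-(1 / 2) : ℝ)..(-(1 / 2) + 1), t ^ 2 := by
    refine intervalIntegral.integral_congr_ae ?_
    -- With this rounding convention `1/2` goes to 1, so the right end point is discarded as a null
    -- set.
    have : ∀ᵐ t : ℝ ∂volume, t ≠ 1 / 2 := by simp [ae_iff]
    filter_upwards [this] with t ht hmem
    rw [Set.uIoc_of_le (by norm_num)] at hmem
    have h0 : round t = 0 := by
      rw [round_eq_zero_iff]
      refine ⟨hmem.1.le, lt_of_le_of_ne (hmem.2.trans (by norm_num)) ht⟩
    simp [roundErrSq, h0]
  rw [h, integral_pow]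
  norm_num

section Gaussian

variable {v : ℝ≥0}

theorem integrable_sq_gaussianReal : Integrable (fun x : ℝ => x ^ 2) (gaussianReal 0 v) :=
  (memLp_id_gaussianReal (μ := 0) (v := v) 2).integrable_sq

theorem integral_sq_gaussianReal : ∫ x, x ^ 2 ∂gaussianReal 0 v = v := by
  have h := variance_eq_sub (memLp_id_gaussianReal (μ := 0) (v := v) 2)
  rw [variance_id_gaussianReal] at h
  simp only [Pi.pow_apply, id] at h
  rw [h, integral_id_gaussianReal]
  simp

theorem logb_gaussianPDFReal (hv : v ≠ 0) (x : ℝ) :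
    Real.logb 2 (gaussianPDFReal 0 v x)
      = -(1 / 2 * Real.logb 2 (2 * Real.pi * v)) - x ^ 2 / (2 * v * Real.log 2) := by
  have hv' : (0 : ℝ) < v := by positivity
  have hp : 0 < 2 * Real.pi * v := by positivity
  have hl : 0 < Real.log 2 := Real.log_pos (by norm_num)
  rw [gaussianPDFReal, Real.logb_mul (by positivity) (Real.exp_pos _).ne', Real.logb_inv,
    Real.sqrt_eq_rpow, Real.logb_rpow_eq_mul_logb_of_pos hp]
  simp only [Real.logb, Real.log_exp]
  field_simp
  ring

theorem integrable_logb_gaussianPDFReal (hv : v ≠ 0) :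
    Integrable (fun x => Real.logb 2 (gaussianPDFReal 0 v x)) (gaussianReal 0 v) := by
  simp only [logb_gaussianPDFReal hv]
  exact (integrable_const _).sub (integrable_sq_gaussianReal.div_const _)

/-- The differential entropy of a Gaussian, in bits. -/
theorem integral_logb_gaussianPDFReal (hv : v ≠ 0) :
    ∫ x, Real.logb 2 (gaussianPDFReal 0 v x) ∂gaussianReal 0 v
      = -(1 / 2 * Real.logb 2 (2 * Real.pi * Real.exp 1 * v)) := by
  have hv' : (0 : ℝ) < v := by positivity
  have hl : 0 < Real.log 2 := Real.log_pos (by norm_num)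
  simp only [logb_gaussianPDFReal hv]
  rw [integral_sub (integrable_const _) (integrable_sq_gaussianReal.div_const _), integral_div,
    integral_sq_gaussianReal, integral_const, probReal_univ, one_smul,
    show 2 * Real.pi * Real.exp 1 * v = 2 * Real.pi * v * Real.exp 1 by ring,
    Real.logb_mul (by positivity) (Real.exp_pos _).ne']
  simp only [Real.logb, Real.log_exp]
  field_simp
  ring

/-- The density cancels. Applied to a quantization cell, the integral is the step size whatever the
offset, which is the input that the converse bound requires. -/
theorem setLIntegral_inv_gaussianPDFReal (hv : v ≠ 0) {s : Set ℝ} (hs : MeasurableSet s) :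
    ∫⁻ x in s, ENNReal.ofReal (gaussianPDFReal 0 v x)⁻¹ ∂gaussianReal 0 v = volume s := by
  rw [gaussianReal_of_var_ne_zero _ hv, setLIntegral_withDensity_eq_setLIntegral_mul _
    (measurable_gaussianPDF 0 v)
    (g := fun x => ENNReal.ofReal (gaussianPDFReal 0 v x)⁻¹)
    (measurable_gaussianPDFReal 0 v).inv.ennreal_ofReal hs, ← setLIntegral_one]
  refine lintegral_congr fun x => ?_
  have h := gaussianPDFReal_pos 0 v x hv
  simp only [Pi.mul_apply, gaussianPDF]
  rw [← ENNReal.ofReal_mul h.le, mul_inv_cancel₀ h.ne', ENNReal.ofReal_one]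

theorem preimage_round_div_add {α : ℝ} (hα : 0 < α) (u : ℝ) (z : ℤ) :
    (fun x : ℝ => round (x / α + u)) ⁻¹' {z}
      = Set.Ico (α * (z - 1 / 2 - u)) (α * (z - 1 / 2 - u) + α) := by
  ext x
  simp only [Set.mem_preimage, Set.mem_singleton_iff, round_eq_iff, Set.mem_Ico,
    ← sub_le_iff_le_add, ← lt_sub_iff_add_lt, le_div_iff₀ hα, div_lt_iff₀ hα]
  constructor <;> rintro ⟨h1, h2⟩ <;> constructor <;> nlinarith

theorem volume_preimage_round_div_add {α : ℝ} (hα : 0 < α) (u : ℝ) (z : ℤ) :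
    volume ((fun x : ℝ => round (x / α + u)) ⁻¹' {z}) = ENNReal.ofReal α := by
  rw [preimage_round_div_add hα, Real.volume_Ico]
  simp

/-- The law of the integer nearest to `x / α`, for a Gaussian `x`. -/
def roundedGaussian (v : ℝ≥0) (α : ℝ) : Measure ℤ :=
  (gaussianReal 0 v).map fun x => round (x / α)

instance (v : ℝ≥0) (α : ℝ) : IsProbabilityMeasure (roundedGaussian v α) :=
  Measure.isProbabilityMeasure_map
    (measurable_round_real.comp (measurable_id.div_const α)).aemeasurable

/-- The cross term `exp (-m t / v)` is replaced by its tangent at `t = 0`, whose linear part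
integrates to zero over a cell centred at `m`. -/
theorem gaussianPDFReal_add_ge (hv : v ≠ 0) (m t : ℝ) :
    gaussianPDFReal 0 v m * Real.exp (-(t ^ 2) / (2 * v)) * (1 - m * t / v)
      ≤ gaussianPDFReal 0 v (m + t) := by
  have hv' : (0 : ℝ) < v := by positivity
  have h : gaussianPDFReal 0 v (m + t) = gaussianPDFReal 0 v m * Real.exp (-(t ^ 2) / (2 * v)) *
      Real.exp (-(m * t / v)) := by
    simp only [gaussianPDFReal, sub_zero]
    rw [mul_assoc _ (Real.exp _) (Real.exp _), ← Real.exp_add,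
      mul_assoc _ (Real.exp _) (Real.exp _), ← Real.exp_add]
    congr 2
    field_simp
    ring
  rw [h]
  have h1 := gaussianPDFReal_nonneg 0 v m
  gcongr
  have := Real.add_one_le_exp (-(m * t / v))
  linarith

theorem roundedGaussian_real_singleton_ge (hv : v ≠ 0) {α : ℝ} (hα : 0 < α) (z : ℤ) :
    α * gaussianPDFReal 0 v (α * z) * Real.exp (-(α ^ 2) / (8 * v))
      ≤ (roundedGaussian v α).real {z} := by
  have hv' : (0 : ℝ) < v := by positivity
  have hm : Measurable fun x : ℝ => round (x / α) :=
    measurable_round_real.comp (measurable_id.div_const α)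
  rw [roundedGaussian, map_measureReal_apply hm (measurableSet_singleton z)]
  have hpre := preimage_round_div_add hα 0 z
  simp only [add_zero, sub_zero] at hpre
  rw [hpre, Measure.real, gaussianReal_apply_eq_integral 0 hv, ENNReal.toReal_ofReal
    (setIntegral_nonneg measurableSet_Ico fun x _ => gaussianPDFReal_nonneg 0 v x),
    integral_Ico_eq_integral_Ioc, ← intervalIntegral.integral_of_le (by linarith)]
  set m := α * (z : ℝ) with hmdef
  have hend : α * (z - 1 / 2) = m + -(α / 2) := by rw [hmdef]; ring
  have hend' : m + -(α / 2) + α = m + α / 2 := by ring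
  rw [hend, hend', ← intervalIntegral.integral_comp_add_left (fun x => gaussianPDFReal 0 v x) m]
  set c := gaussianPDFReal 0 v m * Real.exp (-(α ^ 2) / (8 * v)) with hc
  have hc0 : 0 ≤ c := mul_nonneg (gaussianPDFReal_nonneg _ _ _) (Real.exp_pos _).le
  have hlin : ∫ t in (-(α / 2))..(α / 2), (c - c * m / v * t) = α * c := by
    rw [intervalIntegral.integral_sub (by simp) (Continuous.intervalIntegrable (by fun_prop) _ _), intervalIntegral.integral_const,
      intervalIntegral.integral_const_mul, integral_id]
    simp
  calc α * gaussianPDFReal 0 v m * Real.exp (-(α ^ 2) / (8 * v)) = α * c := by rw [hc]; ring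
    _ = _ := hlin.symm
    _ ≤ _ := ?_
  refine intervalIntegral.integral_mono_on (by linarith)
    (Continuous.intervalIntegrable (by fun_prop) _ _) ?_ fun t ht => ?_
  · exact ((integrable_gaussianPDFReal 0 v).comp_add_left m).intervalIntegrable
  -- Enlarging `t²` to `(α/2)²` in the exponent preserves the bound only if the tangent factor is
  -- nonnegative; otherwise the left side is nonpositive anyway.
  · by_cases hpos : 0 ≤ 1 - m * t / v
    · refine le_trans ?_ (gaussianPDFReal_add_ge hv m t)
      have : c - c * m / v * t = c * (1 - m * t / v) := by ring
      rw [this, hc]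
      have h1 := gaussianPDFReal_nonneg 0 v m
      have h2 : t ^ 2 ≤ (α / 2) ^ 2 := sq_le_sq' ht.1 ht.2
      refine mul_le_mul_of_nonneg_right (mul_le_mul_of_nonneg_left (Real.exp_le_exp.2 ?_) h1) hpos
      rw [div_le_div_iff₀ (by positivity) (by positivity)]
      nlinarith
    · refine le_trans ?_ (gaussianPDFReal_nonneg 0 v (m + t))
      have : c - c * m / v * t = c * (1 - m * t / v) := by ring
      rw [this]
      exact mul_nonpos_of_nonneg_of_nonpos hc0 (by linarith)

theorem neg_logb_roundedGaussian_le (hv : v ≠ 0) {α : ℝ} (hα : 0 < α) (z : ℤ) :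
    0 < (roundedGaussian v α).real {z} ∧
    -Real.logb 2 ((roundedGaussian v α).real {z})
      ≤ 1 / 2 * Real.logb 2 (2 * Real.pi * v) - Real.logb 2 α
        + (α * z) ^ 2 / (2 * v * Real.log 2) + α ^ 2 / (8 * v * Real.log 2) := by
  have hv' : (0 : ℝ) < v := by positivity
  have hl : 0 < Real.log 2 := Real.log_pos (by norm_num)
  have h := roundedGaussian_real_singleton_ge hv hα z
  have hφ := gaussianPDFReal_pos 0 v (α * z) hv
  have hpos : 0 < α * gaussianPDFReal 0 v (α * z) * Real.exp (-(α ^ 2) / (8 * v)) := by positivity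
  refine ⟨hpos.trans_le h, ?_⟩
  have h2 := Real.logb_le_logb_of_le (b := 2) (by norm_num) hpos h
  rw [Real.logb_mul (by positivity) (Real.exp_pos _).ne', Real.logb_mul hα.ne' hφ.ne',
    logb_gaussianPDFReal hv] at h2
  have h3 : Real.logb 2 (Real.exp (-(α ^ 2) / (8 * v))) = -(α ^ 2 / (8 * v * Real.log 2)) := by
    simp only [Real.logb, Real.log_exp]
    field_simp
  rw [h3] at h2
  linarith

theorem integrable_roundErrSq_div_add (μ : Measure ℝ) [IsFiniteMeasure μ] (α u : ℝ) :
    Integrable (fun x => roundErrSq (x / α + u)) μ := by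
  refine Integrable.of_bound (C := 1 / 4) (measurable_roundErrSq.comp
    ((measurable_id.div_const α).add_const u)).aestronglyMeasurable (ae_of_all _ fun x => ?_)
  rw [Real.norm_of_nonneg (roundErrSq_nonneg _)]
  exact roundErrSq_le _

/-- The mean squared error of rounding varies slowly with the offset. -/
theorem integral_roundErrSq_sub_le (hv : v ≠ 0) {α : ℝ} (hα : 0 < α) (u : ℝ) {s : ℝ}
    (hs : |s| ≤ 1) :
    (∫ x, roundErrSq (x / α + u) ∂gaussianReal 0 v) - (α * (1 + v) + α ^ 2) / v
      ≤ ∫ x, roundErrSq (x / α + (u + s)) ∂gaussianReal 0 v := by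
  have hv' : (0 : ℝ) < v := by positivity
  -- Changing the offset by `s` amounts to moving the mean of the Gaussian by `α s`, so it suffices
  -- to compare two densities with nearby means.
  have hshift : ∫ x, roundErrSq (x / α + (u + s)) ∂gaussianReal 0 v
      = ∫ x, roundErrSq (x / α + u) ∂gaussianReal (α * s) v := by
    have h := gaussianReal_map_add_const (μ := 0) (v := v) (α * s)
    rw [zero_add] at h
    rw [← h, integral_map (by fun_prop)
      (integrable_roundErrSq_div_add _ α u).aestronglyMeasurable]
    refine integral_congr_ae (ae_of_all _ fun x => ?_)
    simp only
    congr 1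
    field_simp
    ring
  have hpdf : ∀ x, gaussianPDFReal 0 v x * (1 + (x * (α * s) - (α * s) ^ 2 / 2) / v)
      ≤ gaussianPDFReal (α * s) v x := by
    intro x
    have h : gaussianPDFReal (α * s) v x = gaussianPDFReal 0 v x *
        Real.exp ((x * (α * s) - (α * s) ^ 2 / 2) / v) := by
      simp only [gaussianPDFReal, sub_zero]
      rw [mul_assoc _ (Real.exp _) (Real.exp _), ← Real.exp_add]
      congr 2
      field_simp
      ring
    rw [h]
    have h1 := gaussianPDFReal_nonneg 0 v x
    gcongr
    have := Real.add_one_le_exp ((x * (α * s) - (α * s) ^ 2 / 2) / v)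
    linarith
  have hbound : ∀ x, roundErrSq (x / α + u) - (α * (1 + x ^ 2) + α ^ 2) / v
      ≤ roundErrSq (x / α + u) * (1 + (x * (α * s) - (α * s) ^ 2 / 2) / v) := by
    intro x
    have h0 := roundErrSq_nonneg (x / α + u)
    have h1 := roundErrSq_le (x / α + u)
    have hx : |x| ≤ 1 + x ^ 2 := by
      rw [← sq_abs]; nlinarith [sq_nonneg (|x| - 1), abs_nonneg x]
    have hs2 : s ^ 2 ≤ 1 := by rw [← sq_abs]; nlinarith [abs_nonneg s]
    have h2 : -(α * (1 + x ^ 2) + α ^ 2) ≤ x * (α * s) - (α * s) ^ 2 / 2 := by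
      have e1 : |x * (α * s)| ≤ α * (1 + x ^ 2) := by
        rw [abs_mul, abs_mul, abs_of_pos hα]
        have : |x| * (α * |s|) ≤ (1 + x ^ 2) * (α * 1) := by gcongr
        linarith
      have e2 := (abs_le.1 e1).1
      have e3 : (α * s) ^ 2 ≤ α ^ 2 := by rw [mul_pow]; nlinarith [sq_nonneg α]
      nlinarith [sq_nonneg α]
    have h3 : -((α * (1 + x ^ 2) + α ^ 2) / v) ≤ (x * (α * s) - (α * s) ^ 2 / 2) / v := by
      rw [← neg_div]; gcongr
    have h4 : 0 ≤ (α * (1 + x ^ 2) + α ^ 2) / v := by positivity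
    nlinarith
  have hIx : Integrable (fun x : ℝ => (α * (1 + x ^ 2) + α ^ 2) / v) (gaussianReal 0 v) :=
    ((((integrable_const (1 : ℝ)).add integrable_sq_gaussianReal).const_mul α).add
      (integrable_const _)).div_const _
  have hIl : Integrable (fun x => roundErrSq (x / α + u) - (α * (1 + x ^ 2) + α ^ 2) / v)
      (gaussianReal 0 v) := (integrable_roundErrSq_div_add _ α u).sub hIx
  have hleft : ∫ x, (roundErrSq (x / α + u) - (α * (1 + x ^ 2) + α ^ 2) / v) ∂gaussianReal 0 v
      = (∫ x, roundErrSq (x / α + u) ∂gaussianReal 0 v) - (α * (1 + v) + α ^ 2) / v := by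
    rw [integral_sub (integrable_roundErrSq_div_add _ α u) hIx, integral_div,
      integral_add (f := fun x => α * (1 + x ^ 2))
        (((integrable_const (1 : ℝ)).add integrable_sq_gaussianReal).const_mul α)
        (integrable_const _), integral_const_mul,
      integral_add (integrable_const _) integrable_sq_gaussianReal, integral_sq_gaussianReal]
    simp
  have hsm : ∀ (m : ℝ) (f : ℝ → ℝ), Integrable f (gaussianReal m v) →
      Integrable (fun x => gaussianPDFReal m v x * f x) := by
    intro m f hf
    rw [gaussianReal_of_var_ne_zero _ hv] at hf
    have := (integrable_withDensity_iff_integrable_smul' (measurable_gaussianPDF m v)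
      (ae_of_all _ fun x => gaussianPDF_lt_top)).1 hf
    simpa [toReal_gaussianPDF] using this
  rw [hshift, ← hleft, integral_gaussianReal_eq_integral_smul hv,
    integral_gaussianReal_eq_integral_smul hv]
  simp only [smul_eq_mul]
  refine integral_mono (hsm _ _ hIl) (hsm _ _ (integrable_roundErrSq_div_add _ α u)) fun x => ?_
  simp only
  have h1 := gaussianPDFReal_nonneg 0 v x
  calc gaussianPDFReal 0 v x * (roundErrSq (x / α + u) - (α * (1 + x ^ 2) + α ^ 2) / v)
      ≤ gaussianPDFReal 0 v x *
        (roundErrSq (x / α + u) * (1 + (x * (α * s) - (α * s) ^ 2 / 2) / v)) := by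
        gcongr; exact hbound x
    _ = gaussianPDFReal 0 v x * (1 + (x * (α * s) - (α * s) ^ 2 / 2) / v)
        * roundErrSq (x / α + u) := by ring
    _ ≤ _ := mul_le_mul_of_nonneg_right (hpdf x) (roundErrSq_nonneg _)

/-- By Fubini, a uniform dither makes the error exactly `1/12` for each fixed input, so no smallness
of `α` is needed. -/
theorem integral_integral_roundErrSq (α u : ℝ) :
    ∫ w in (0 : ℝ)..1, ∫ x, roundErrSq (x / α + (u + w)) ∂gaussianReal 0 v = 1 / 12 := by
  have hm : Measurable (Function.uncurry fun w x : ℝ => roundErrSq (x / α + (u + w))) :=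
    measurable_roundErrSq.comp (by fun_prop)
  rw [intervalIntegral.integral_of_le zero_le_one, integral_integral_swap]
  · have : ∀ x : ℝ, ∫ w in Set.Ioc (0 : ℝ) 1, roundErrSq (x / α + (u + w)) = 1 / 12 := by
      intro x
      rw [← intervalIntegral.integral_of_le zero_le_one]
      simp only [← add_assoc]
      exact integral_roundErrSq_add _
    simp [this]
  · refine Integrable.of_bound (C := 1 / 4) hm.aestronglyMeasurable (ae_of_all _ fun p => ?_)
    rw [Function.uncurry, Real.norm_of_nonneg (roundErrSq_nonneg _)]
    exact roundErrSq_le _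

/-- As a function of the offset, the mean error averages to `1/12` over a period and changes by at
most the right side within one, so each value is that close to `1/12`. -/
theorem abs_integral_roundErrSq_sub_le (hv : v ≠ 0) {α : ℝ} (hα : 0 < α) (u : ℝ) :
    |(∫ x, roundErrSq (x / α + u) ∂gaussianReal 0 v) - 1 / 12| ≤ (α * (1 + v) + α ^ 2) / v := by
  set F : ℝ → ℝ := fun u => ∫ x, roundErrSq (x / α + u) ∂gaussianReal 0 v with hF
  set δ := (α * (1 + v) + α ^ 2) / v with hδ
  have hm : Measurable (Function.uncurry fun w x : ℝ => roundErrSq (x / α + (u + w))) :=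
    measurable_roundErrSq.comp (by fun_prop)
  have hFm : StronglyMeasurable fun w => F (u + w) :=
    hm.stronglyMeasurable.integral_prod_right (ν := gaussianReal 0 v)
  have hFi : IntervalIntegrable (fun w => F (u + w)) volume 0 1 := by
    rw [intervalIntegrable_iff]
    refine Measure.integrableOn_of_bounded (M := 1 / 4) (by simp)
      hFm.aestronglyMeasurable (ae_of_all _ fun t => ?_)
    have h := norm_integral_le_of_norm_le_const (μ := gaussianReal 0 v) (C := 1 / 4)
      (f := fun x => roundErrSq (x / α + (u + t))) (ae_of_all _ fun x => by
        rw [Real.norm_of_nonneg (roundErrSq_nonneg _)]; exact roundErrSq_le _)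
    simpa using h
  have hint : ∫ w in (0 : ℝ)..1, F (u + w) = 1 / 12 := integral_integral_roundErrSq α u
  have h1 : ∫ w in (0 : ℝ)..1, F (u + w) ≤ ∫ _ in (0 : ℝ)..1, (F u + δ) := by
    refine intervalIntegral.integral_mono_on zero_le_one hFi (by simp) fun w hw => ?_
    have := integral_roundErrSq_sub_le hv hα (u + w) (s := -w)
      (by rw [abs_neg, abs_of_nonneg hw.1]; exact hw.2)
    rw [add_neg_cancel_right] at this
    simp only [hF, hδ]
    linarith
  have h2 : ∫ _ in (0 : ℝ)..1, (F u - δ) ≤ ∫ w in (0 : ℝ)..1, F (u + w) := by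
    refine intervalIntegral.integral_mono_on zero_le_one (by simp) hFi fun w hw => ?_
    exact integral_roundErrSq_sub_le hv hα u (by rw [abs_of_nonneg hw.1]; exact hw.2)
  rw [hint] at h1 h2
  simp only [intervalIntegral.integral_const, sub_zero, one_smul] at h1 h2
  rw [abs_le]
  constructor <;> linarith

theorem lintegral_roundErrSq (α u : ℝ) :
    ∫⁻ x, ENNReal.ofReal (roundErrSq (x / α + u)) ∂gaussianReal 0 v
      = ENNReal.ofReal (∫ x, roundErrSq (x / α + u) ∂gaussianReal 0 v) :=
  (ofReal_integral_eq_lintegral_ofReal (integrable_roundErrSq_div_add _ α u)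
    (ae_of_all _ fun _ => roundErrSq_nonneg _)).symm

/-- The mean squared error of a quantizer whose step is bounded below is bounded below. -/
theorem exists_pos_le_lintegral_roundErrSq (hv : v ≠ 0) {ε : ℝ} (hε : 0 < ε) :
    ∃ κ : ℝ, 0 < κ ∧ ∀ α, ε ≤ α →
      ENNReal.ofReal κ ≤ ∫⁻ x, ENNReal.ofReal (α ^ 2 * roundErrSq (x / α)) ∂gaussianReal 0 v := by
  -- On this interval `x / α` rounds to 0 for every `α ≥ ε`, so the error is `x²`, independently of
  -- `α`.
  set s : Set ℝ := Set.Ioo (ε / 4) (ε / 2) with hs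
  have hpos : 0 < gaussianReal 0 v s := by
    rw [pos_iff_ne_zero]
    intro h
    have := gaussianReal_absolutelyContinuous' 0 hv h
    rw [hs, Real.volume_Ioo] at this
    simp only [ENNReal.ofReal_eq_zero] at this
    linarith
  have hreal : 0 < (gaussianReal 0 v).real s :=
    ENNReal.toReal_pos hpos.ne' (measure_ne_top _ _)
  refine ⟨(ε / 4) ^ 2 * (gaussianReal 0 v).real s, by positivity, fun α hα => ?_⟩
  calc ENNReal.ofReal ((ε / 4) ^ 2 * (gaussianReal 0 v).real s)
      = ∫⁻ _ in s, ENNReal.ofReal ((ε / 4) ^ 2) ∂gaussianReal 0 v := by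
        rw [setLIntegral_const, ENNReal.ofReal_mul (by positivity), Measure.real,
          ENNReal.ofReal_toReal (measure_ne_top _ _)]
    _ ≤ ∫⁻ x in s, ENNReal.ofReal (α ^ 2 * roundErrSq (x / α)) ∂gaussianReal 0 v := by
        refine setLIntegral_mono' measurableSet_Ioo fun x hx => ENNReal.ofReal_le_ofReal ?_
        have hα0 : 0 < α := hε.trans_le hα
        have h0 : round (x / α) = 0 := by
          rw [round_eq_zero_iff]
          constructor
          · have : 0 ≤ x / α := div_nonneg (by linarith [hx.1]) hα0.le
            linarith
          · rw [div_lt_iff₀ hα0]; linarith [hx.2]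
        have : α ^ 2 * roundErrSq (x / α) = x ^ 2 := by
          rw [roundErrSq, h0]; field_simp; simp
        rw [this]
        have := hx.1
        gcongr
    _ ≤ _ := setLIntegral_le_lintegral _ _

end Gaussian

/-! ### The recursion solved by the ZSIC algorithm -/

section Recursion

variable {a n : ℕ}

/-- Loop invariant, by induction on the last column treated. The decreasing order guarantees that a
step leaves the indices found earlier untouched and that the columns already subtracted are those
with larger index. -/
theorem zsicStep_foldl (Y : Matrix (Fin a) (Fin n) ℝ) (L : Matrix (Fin n) (Fin n) ℝ)
    (α : Fin n → ℝ) (l : List (Fin n)) (hl : l.Pairwise (· > ·)) :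
    (∀ r j, (l.foldl (zsicStep L α) (Y, 0)).1 r j = Y r j -
      ∑ k ∈ l.toFinset, α k * ((l.foldl (zsicStep L α) (Y, 0)).2 r k : ℝ) * L k j) ∧
    ∀ r, ∀ i ∈ l, (l.foldl (zsicStep L α) (Y, 0)).2 r i = round ((Y r i -
      ∑ k ∈ l.toFinset with i < k, α k * ((l.foldl (zsicStep L α) (Y, 0)).2 r k : ℝ) * L k i) /
        (α i * L i i)) := by
  induction l using List.reverseRecOn with
  | nil => simp
  | append_singleton l i ih =>
    rw [List.pairwise_append] at hl
    obtain ⟨hl1, -, hl2⟩ := hl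
    obtain ⟨ih1, ih2⟩ := ih hl1
    rw [List.foldl_append, List.foldl_cons, List.foldl_nil]
    set s := l.foldl (zsicStep L α) (Y, 0) with hs
    have hgt : ∀ k ∈ l, i < k := fun k hk => hl2 k hk i (by simp)
    have hil : i ∉ l := fun h => lt_irrefl _ (hgt i h)
    have hst : ∀ r, ∀ k ∈ l, (zsicStep L α s i).2 r k = s.2 r k := by
      intro r k hk
      have : k ≠ i := fun h => hil (h ▸ hk)
      simp [zsicStep, this]
    have hsi : ∀ r, (zsicStep L α s i).2 r i = round (s.1 r i / (α i * L i i)) := by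
      intro r
      simp [zsicStep]
    have hfin : (l ++ [i]).toFinset = insert i l.toFinset := by
      ext k; simp
    have hil' : i ∉ l.toFinset := by simpa using hil
    refine ⟨fun r j => ?_, fun r k hk => ?_⟩
    · rw [hfin, Finset.sum_insert hil', hsi]
      rw [Finset.sum_congr rfl (g := fun k => α k * (s.2 r k : ℝ) * L k j)
        fun k hk => by rw [hst r k (by simpa using hk)]]
      have := ih1 r j
      simp only [zsicStep, Matrix.sub_apply, Matrix.of_apply]
      rw [this]
      ring
    · rcases List.mem_append.1 hk with hk | hk
      · rw [hst r k hk, ih2 r k hk]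
        rw [hfin, Finset.filter_insert, if_neg (not_lt.2 (hgt k hk).le)]
        rw [Finset.sum_congr rfl fun j hj => (by
          rw [hst r j (by simpa using (Finset.mem_filter.1 hj).1)] :
            α j * ((zsicStep L α s i).2 r j : ℝ) * L j k = α j * (s.2 r j : ℝ) * L j k)]
      · obtain rfl : k = i := by simpa using hk
        rw [hsi, ih1, hfin, Finset.filter_insert, if_neg (lt_irrefl _), Finset.filter_true_of_mem
          (fun j hj => hgt j (by simpa using hj))]
        rw [Finset.sum_congr rfl fun j hj => (by rw [hst r j (by simpa using hj)] :
          α j * ((zsicStep L α s k).2 r j : ℝ) * L j k = α j * (s.2 r j : ℝ) * L j k)]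

/-- The feedback that reaches column `i` from the quantization errors of the columns after it, in
units of the quantization step. -/
def feedback (L : Matrix (Fin n) (Fin n) ℝ) (α : Fin n → ℝ) (x : Fin n → ℝ) (z : Fin n → ℤ)
    (i : Fin n) : ℝ :=
  (∑ k ∈ Finset.Ioi i, (x k - α k * z k) * L k i) / (α i * L i i)

theorem sum_mul_lower {L : Matrix (Fin n) (Fin n) ℝ} (hL : ∀ i j : Fin n, i < j → L i j = 0)
    (x : Fin n → ℝ) (i : Fin n) :
    ∑ k, x k * L k i = x i * L i i + ∑ k ∈ Finset.Ioi i, x k * L k i := by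
  rw [← Finset.add_sum_erase _ _ (Finset.mem_univ i)]
  congr 1
  symm
  refine Finset.sum_subset (fun k hk => ?_) fun k hk hk' => ?_
  · simp [(Finset.mem_Ioi.1 hk).ne']
  · have h1 : k ≠ i := by simpa using hk
    have h2 : ¬ i < k := by simpa using hk'
    rw [hL k i (lt_of_le_of_ne (not_lt.1 h2) h1), mul_zero]

/-- By triangularity only columns `k ≥ i` enter `(W L)_{:,i}`; subtracting the reconstructed later
columns leaves `W_i ℓ_ii` plus their errors weighted by `L k i`. -/
theorem quantIdx_eq_round {L : Matrix (Fin n) (Fin n) ℝ} (hL : ∀ i j : Fin n, i < j → L i j = 0)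
    {α : Fin n → ℝ} (hα : ∀ i, α i ≠ 0) (hLd : ∀ i, L i i ≠ 0) (W : Matrix (Fin a) (Fin n) ℝ)
    (r : Fin a) (i : Fin n) :
    quantIdx L α W r i
      = round (W r i / α i + feedback L α (W r) (quantIdx L α W r) i) := by
  have h := (zsicStep_foldl (W * L) L α (List.finRange n).reverse
    (by rw [List.pairwise_reverse]; exact List.pairwise_lt_finRange n)).2 r i (by simp)
  change quantIdx L α W r i = round (((W * L) r i - ∑ k ∈ _ with i < k,
    α k * (quantIdx L α W r k : ℝ) * L k i) / (α i * L i i)) at h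
  rw [h]
  have hα' := hα i
  have hLd' := hLd i
  have hfin : ((List.finRange n).reverse.toFinset.filter (i < ·)) = Finset.Ioi i := by
    ext k; simp
  congr 1
  rw [hfin, feedback, Matrix.mul_apply, sum_mul_lower hL, div_add_div _ _ hα' (by positivity),
    div_eq_div_iff (by positivity) (by positivity)]
  simp only [sub_mul, Finset.sum_sub_distrib]
  ring

/-- The indices that ZSIC assigns to a single row of weights. -/
def rowIdx (L : Matrix (Fin n) (Fin n) ℝ) (α : Fin n → ℝ) (x : Fin n → ℝ) : Fin n → ℤ :=
  quantIdx L α (Matrix.of fun _ : Fin 1 => x) 0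

/-- The real number that is rounded to obtain the index of column `i`. -/
def rowArg (L : Matrix (Fin n) (Fin n) ℝ) (α : Fin n → ℝ) (x : Fin n → ℝ) (i : Fin n) : ℝ :=
  x i / α i + feedback L α x (rowIdx L α x) i

variable {L : Matrix (Fin n) (Fin n) ℝ} {α : Fin n → ℝ}

theorem rowIdx_eq_round (hL : ∀ i j : Fin n, i < j → L i j = 0) (hα : ∀ i, α i ≠ 0)
    (hLd : ∀ i, L i i ≠ 0) (x : Fin n → ℝ) (i : Fin n) :
    rowIdx L α x i = round (rowArg L α x i) :=
  quantIdx_eq_round hL hα hLd (Matrix.of fun _ : Fin 1 => x) 0 i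

/-- The implicit equation is solved from the last column downwards, so it has a unique solution and
`z i` depends only on the `x k` with `k ≥ i`. -/
theorem eq_of_eq_round_feedback {x y : Fin n → ℝ} {z z' : Fin n → ℤ}
    (hz : ∀ i, z i = round (x i / α i + feedback L α x z i))
    (hz' : ∀ i, z' i = round (y i / α i + feedback L α y z' i)) (i : Fin n)
    (hxy : ∀ k, i ≤ k → x k = y k) : z i = z' i := by
  induction i using WellFoundedGT.induction with
  | ind i ih =>
    rw [hz i, hz' i, hxy i le_rfl]
    congr 2
    unfold feedback
    congr 1
    refine Finset.sum_congr rfl fun k hk => ?_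
    have hk' := Finset.mem_Ioi.1 hk
    rw [ih k hk' fun j hj => hxy j (hk'.le.trans hj), hxy k hk'.le]

theorem quantIdx_eq_rowIdx (hL : ∀ i j : Fin n, i < j → L i j = 0) (hα : ∀ i, α i ≠ 0)
    (hLd : ∀ i, L i i ≠ 0) (W : Matrix (Fin a) (Fin n) ℝ) (r : Fin a) (i : Fin n) :
    quantIdx L α W r i = rowIdx L α (W r) i :=
  eq_of_eq_round_feedback (quantIdx_eq_round hL hα hLd W r) (rowIdx_eq_round hL hα hLd (W r)) i
    fun _ _ => rfl

/-- This decouples the columns: under the product law, the offset seen by column `i` is independent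
of `x i`. -/
theorem feedback_update (hL : ∀ i j : Fin n, i < j → L i j = 0) (hα : ∀ i, α i ≠ 0)
    (hLd : ∀ i, L i i ≠ 0) (x : Fin n → ℝ) (i : Fin n) (y : ℝ) :
    feedback L α (Function.update x i y) (rowIdx L α (Function.update x i y)) i
      = feedback L α x (rowIdx L α x) i := by
  unfold feedback
  congr 1
  refine Finset.sum_congr rfl fun k hk => ?_
  have hne : ∀ j, i < j → Function.update x i y j = x j := fun j hj => by simp [hj.ne']
  have hk' := Finset.mem_Ioi.1 hk
  rw [hne k hk', eq_of_eq_round_feedback (rowIdx_eq_round hL hα hLd _)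
    (rowIdx_eq_round hL hα hLd x) k fun j hj => hne j (hk'.trans_le hj)]

theorem rowArg_update (hL : ∀ i j : Fin n, i < j → L i j = 0) (hα : ∀ i, α i ≠ 0)
    (hLd : ∀ i, L i i ≠ 0) (x : Fin n → ℝ) (i : Fin n) (y : ℝ) :
    rowArg L α (Function.update x i y) i = y / α i + feedback L α x (rowIdx L α x) i := by
  rw [rowArg, feedback_update hL hα hLd, Function.update_self]

theorem measurable_rowIdx (hL : ∀ i j : Fin n, i < j → L i j = 0) (hα : ∀ i, α i ≠ 0)
    (hLd : ∀ i, L i i ≠ 0) (i : Fin n) : Measurable fun x => rowIdx L α x i := by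
  induction i using WellFoundedGT.induction with
  | ind i ih =>
    have heq : (fun x => rowIdx L α x i) = fun x => round (rowArg L α x i) :=
      funext fun x => rowIdx_eq_round hL hα hLd x i
    rw [heq]
    unfold rowArg feedback
    refine measurable_round_real.comp (((measurable_pi_apply i).div_const _).add
      (Measurable.div_const (Finset.measurable_sum _ fun k hk => ?_) _))
    exact ((measurable_pi_apply k).sub (((measurable_from_top (f := fun z : ℤ => (z : ℝ))).comp
      (ih k (Finset.mem_Ioi.1 hk))).const_mul _)).mul_const _

theorem measurable_rowArg (hL : ∀ i j : Fin n, i < j → L i j = 0) (hα : ∀ i, α i ≠ 0)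
    (hLd : ∀ i, L i i ≠ 0) (i : Fin n) : Measurable fun x => rowArg L α x i := by
  refine ((measurable_pi_apply i).div_const _).add
    (Measurable.div_const (Finset.measurable_sum _ fun k _ => ?_) _)
  exact ((measurable_pi_apply k).sub (((measurable_from_top (f := fun z : ℤ => (z : ℝ))).comp
    (measurable_rowIdx hL hα hLd k)).const_mul _)).mul_const _

/-- In the coordinates given by `L`, the error of column `i` is a scaled rounding error. -/
theorem sum_error_mul (hL : ∀ i j : Fin n, i < j → L i j = 0) (hα : ∀ i, α i ≠ 0)
    (hLd : ∀ i, L i i ≠ 0) (x : Fin n → ℝ) (i : Fin n) :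
    ∑ k, (x k - α k * rowIdx L α x k) * L k i
      = α i * L i i * (rowArg L α x i - round (rowArg L α x i)) := by
  have hα' := hα i
  have hLd' := hLd i
  rw [sum_mul_lower hL, ← rowIdx_eq_round hL hα hLd, rowArg, feedback]
  field_simp
  ring

/-- The error `e` equals `(e L) L⁻¹`, and each entry of `e L` is a rounding error times `α_k ℓ_kk`.
The bound is uniform in `x` and linear in the spacings. -/
theorem abs_error_le (hL : ∀ i j : Fin n, i < j → L i j = 0) (hα : ∀ i, α i ≠ 0)
    (hLd : ∀ i, L i i ≠ 0) (x : Fin n → ℝ) (i : Fin n) :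
    |x i - α i * rowIdx L α x i| ≤ ∑ k, |α k| * |L k k| * |L⁻¹ k i| := by
  have hdet : IsUnit L.det := by
    rw [Matrix.det_of_isLowerTriangular L (fun i j h => hL i j h)]
    exact (Finset.prod_ne_zero_iff.2 fun i _ => hLd i).isUnit
  set e : Fin n → ℝ := fun k => x k - α k * rowIdx L α x k with he
  have h1 : e = (e ᵥ* L) ᵥ* L⁻¹ := by
    rw [Matrix.vecMul_vecMul, Matrix.mul_nonsing_inv L hdet, Matrix.vecMul_one]
  have h2 : e i = ∑ k, (e ᵥ* L) k * L⁻¹ k i := congrFun h1 i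
  change |e i| ≤ _
  rw [h2]
  refine (Finset.abs_sum_le_sum_abs _ _).trans (Finset.sum_le_sum fun k _ => ?_)
  have h3 : (e ᵥ* L) k = α k * L k k * (rowArg L α x k - round (rowArg L α x k)) :=
    sum_error_mul hL hα hLd x k
  rw [abs_mul, h3, abs_mul, abs_mul]
  have h4 : |rowArg L α x k - round (rowArg L α x k)| ≤ 1 :=
    (abs_sub_round _).trans (by norm_num)
  have h5 : 0 ≤ |α k| * |L k k| := by positivity
  exact mul_le_mul_of_nonneg_right (mul_le_of_le_one_right h5 h4) (abs_nonneg _)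

/-- The trace in the distortion, in terms of rounding errors. -/
theorem trace_error (hL : ∀ i j : Fin n, i < j → L i j = 0) (hα : ∀ i, α i ≠ 0)
    (hLd : ∀ i, L i i ≠ 0) (W : Matrix (Fin a) (Fin n) ℝ) :
    ((W - reconstruct α (quantIdx L α W)) * (L * Lᵀ) *
      (W - reconstruct α (quantIdx L α W))ᵀ).trace
      = ∑ r, ∑ i, (α i * L i i) ^ 2 * roundErrSq (rowArg L α (W r) i) := by
  set E := W - reconstruct α (quantIdx L α W) with hE
  have h1 : E * (L * Lᵀ) * Eᵀ = (E * L) * (E * L)ᵀ := by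
    rw [Matrix.transpose_mul]; simp only [Matrix.mul_assoc]
  rw [h1, Matrix.trace]
  refine Finset.sum_congr rfl fun r _ => ?_
  rw [Matrix.diag_apply, Matrix.mul_apply]
  refine Finset.sum_congr rfl fun i _ => ?_
  rw [Matrix.transpose_apply, roundErrSq, ← mul_pow, ← sum_error_mul hL hα hLd (W r) i,
    Matrix.mul_apply, sq]
  congr 1 <;>
  · refine Finset.sum_congr rfl fun k _ => ?_
    rw [hE, Matrix.sub_apply, reconstruct, Matrix.mul_diagonal, Matrix.map_apply,
      quantIdx_eq_rowIdx hL hα hLd, mul_comm (α k)]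

end Recursion

/-! ### Integration over one coordinate -/

section Coordinate

variable {ι : Type*} [Fintype ι] [DecidableEq ι] {X : ι → Type*} [∀ i, MeasurableSpace (X i)]
  {μ : ∀ i, Measure (X i)} [∀ i, IsProbabilityMeasure (μ i)]

/-- A substitute for conditioning on all coordinates but one: integrate over coordinate `i` first,
with a bound uniform in the others. -/
theorem lintegral_pi_le_of_update {f : (∀ i, X i) → ℝ≥0∞} (hf : Measurable f) (i : ι) {c : ℝ≥0∞}
    (h : ∀ x, ∫⁻ y, f (Function.update x i y) ∂μ i ≤ c) : ∫⁻ x, f x ∂Measure.pi μ ≤ c := by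
  have := lintegral_le_of_lmarginal_le (μ := μ) {i} hf (measurable_const (a := c)) (fun x => by
    rw [lmarginal_singleton, lmarginal_singleton]
    simpa using h x)
  simpa using this

theorem le_lintegral_pi_of_update {f : (∀ i, X i) → ℝ≥0∞} (hf : Measurable f) (i : ι) {c : ℝ≥0∞}
    (h : ∀ x, c ≤ ∫⁻ y, f (Function.update x i y) ∂μ i) : c ≤ ∫⁻ x, f x ∂Measure.pi μ := by
  have := lintegral_le_of_lmarginal_le (μ := μ) {i} (measurable_const (a := c)) hf (fun x => by
    rw [lmarginal_singleton, lmarginal_singleton]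
    simpa using h x)
  simpa using this

end Coordinate

theorem ofReal_sum_le_sum_ofReal {ι : Type*} (s : Finset ι) (f : ι → ℝ) :
    ENNReal.ofReal (∑ i ∈ s, f i) ≤ ∑ i ∈ s, ENNReal.ofReal (f i) := by
  classical
  induction s using Finset.induction_on with
  | empty => simp
  | insert i s hi ih =>
    rw [Finset.sum_insert hi, Finset.sum_insert hi]
    exact ENNReal.ofReal_add_le.trans (by gcongr)

theorem ofReal_div_natCast_mul {n a : ℕ} (hn : 0 < n) (ha : 0 < a) (x : ℝ) :
    ENNReal.ofReal x / ((n : ℝ≥0∞) * (a : ℝ≥0∞)) = ENNReal.ofReal (x / (n * a)) := by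
  rw [ENNReal.ofReal_div_of_pos (by positivity), ENNReal.ofReal_mul (by positivity),
    ENNReal.ofReal_natCast, ENNReal.ofReal_natCast]

/-! ### Distortion and rate for fixed spacings -/

section Bounds

variable {a n : ℕ} {σ : ℝ≥0} {L : Matrix (Fin n) (Fin n) ℝ} {α : Fin n → ℝ}

/-- The law of a row of weights. -/
def rowLaw (n : ℕ) (σ : ℝ≥0) : Measure (Fin n → ℝ) :=
  Measure.pi fun _ => gaussianReal 0 (σ ^ 2)

instance (n : ℕ) (σ : ℝ≥0) : IsProbabilityMeasure (rowLaw n σ) :=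
  inferInstanceAs (IsProbabilityMeasure (Measure.pi _))

theorem weightLaw_eq (a n : ℕ) (σ : ℝ≥0) : weightLaw a n σ = Measure.pi fun _ => rowLaw n σ := rfl

instance (a n : ℕ) (σ : ℝ≥0) : IsProbabilityMeasure (weightLaw a n σ) :=
  inferInstanceAs (IsProbabilityMeasure (Measure.pi fun _ => rowLaw n σ))

/-- The mean squared rounding error in column `i`. -/
def meanRoundErr (σ : ℝ≥0) (L : Matrix (Fin n) (Fin n) ℝ) (α : Fin n → ℝ) (i : Fin n) : ℝ :=
  ∫ x, roundErrSq (rowArg L α x i) ∂rowLaw n σ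

theorem meanRoundErr_nonneg (i : Fin n) : 0 ≤ meanRoundErr σ L α i :=
  integral_nonneg fun _ => roundErrSq_nonneg _

variable (hL : ∀ i j : Fin n, i < j → L i j = 0) (hα : ∀ i, 0 < α i) (hLd : ∀ i, L i i ≠ 0)

section
include hL hα hLd

theorem measurable_roundErrSq_rowArg (i : Fin n) :
    Measurable fun x => roundErrSq (rowArg L α x i) :=
  measurable_roundErrSq.comp (measurable_rowArg hL (fun i => (hα i).ne') hLd i)

theorem integrable_roundErrSq_rowArg (i : Fin n) :
    Integrable (fun x => roundErrSq (rowArg L α x i)) (rowLaw n σ) := by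
  refine Integrable.of_bound (C := 1 / 4)
    (measurable_roundErrSq_rowArg hL hα hLd i).aestronglyMeasurable (ae_of_all _ fun x => ?_)
  rw [Real.norm_of_nonneg (roundErrSq_nonneg _)]
  exact roundErrSq_le _

theorem lintegral_roundErrSq_rowArg (i : Fin n) :
    ∫⁻ x, ENNReal.ofReal (roundErrSq (rowArg L α x i)) ∂rowLaw n σ
      = ENNReal.ofReal (meanRoundErr σ L α i) :=
  (ofReal_integral_eq_lintegral_ofReal (integrable_roundErrSq_rowArg hL hα hLd i)
    (ae_of_all _ fun _ => roundErrSq_nonneg _)).symm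

theorem abs_meanRoundErr_sub_le (hσ : 0 < σ) (i : Fin n) :
    |meanRoundErr σ L α i - 1 / 12| ≤ (α i * (1 + σ ^ 2) + α i ^ 2) / σ ^ 2 := by
  have hv : σ ^ 2 ≠ 0 := (pow_pos hσ 2).ne'
  have hm := (measurable_roundErrSq_rowArg hL hα hLd i).ennreal_ofReal
  have hα' : ∀ i, α i ≠ 0 := fun i => (hα i).ne'
  have hrow : ∀ x : Fin n → ℝ, ∫⁻ y, ENNReal.ofReal (roundErrSq
      (rowArg L α (Function.update x i y) i)) ∂gaussianReal 0 (σ ^ 2)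
        = ENNReal.ofReal (∫ y, roundErrSq (y / α i + feedback L α x (rowIdx L α x) i)
          ∂gaussianReal 0 (σ ^ 2)) := by
    intro x
    simp only [rowArg_update hL hα' hLd]
    exact lintegral_roundErrSq _ _
  have hb : ∀ u, |(∫ y, roundErrSq (y / α i + u) ∂gaussianReal 0 (σ ^ 2)) - 1 / 12|
      ≤ (α i * (1 + σ ^ 2) + α i ^ 2) / σ ^ 2 := fun u => by
    simpa using abs_integral_roundErrSq_sub_le hv (hα i) u
  set δ := (α i * (1 + (σ : ℝ) ^ 2) + α i ^ 2) / (σ : ℝ) ^ 2 with hδ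
  have h1 : ENNReal.ofReal (meanRoundErr σ L α i) ≤ ENNReal.ofReal (1 / 12 + δ) := by
    rw [← lintegral_roundErrSq_rowArg hL hα hLd i]
    refine lintegral_pi_le_of_update hm i fun x => ?_
    rw [hrow x]
    exact ENNReal.ofReal_le_ofReal (by linarith [(abs_le.1 (hb (feedback L α x (rowIdx L α x) i))).2])
  have h2 : ENNReal.ofReal (1 / 12 - δ) ≤ ENNReal.ofReal (meanRoundErr σ L α i) := by
    rw [← lintegral_roundErrSq_rowArg hL hα hLd i]
    refine le_lintegral_pi_of_update hm i fun x => ?_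
    rw [hrow x]
    exact ENNReal.ofReal_le_ofReal (by linarith [(abs_le.1 (hb (feedback L α x (rowIdx L α x) i))).1])
  have hδ0 : 0 ≤ δ := (abs_nonneg _).trans (hb 0)
  rw [ENNReal.ofReal_le_ofReal_iff (by linarith)] at h1
  rw [ENNReal.ofReal_le_ofReal_iff (meanRoundErr_nonneg i)] at h2
  rw [abs_le]
  constructor <;> linarith

/-- Exact at every resolution. The rows are identically distributed and quantized separately, so `a`
drops out. -/
theorem distortion_eq (hn : 0 < n) (ha : 0 < a) :
    distortion a σ (L * Lᵀ) L α
      = ENNReal.ofReal ((1 / n) * ∑ i, (α i * L i i) ^ 2 * meanRoundErr σ L α i) := by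
  have hα' : ∀ i, α i ≠ 0 := fun i => (hα i).ne'
  have hI : ∀ (i : Fin n) (r : Fin a), Integrable (fun w : Fin a → Fin n → ℝ =>
      (α i * L i i) ^ 2 * roundErrSq (rowArg L α (w r) i)) (weightLaw a n σ) := fun i r =>
    (integrable_comp_eval (μ := fun _ : Fin a => rowLaw n σ) (i := r)
      (integrable_roundErrSq_rowArg hL hα hLd i)).const_mul _
  have hval : ∀ (i : Fin n) (r : Fin a), ∫ w : Fin a → Fin n → ℝ,
      (α i * L i i) ^ 2 * roundErrSq (rowArg L α (w r) i) ∂weightLaw a n σ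
        = (α i * L i i) ^ 2 * meanRoundErr σ L α i := fun i r => by
    rw [integral_const_mul, weightLaw_eq, meanRoundErr,
      ← integral_comp_eval (μ := fun _ : Fin a => rowLaw n σ) (i := r)
        (integrable_roundErrSq_rowArg hL hα hLd i).aestronglyMeasurable]
  have hdist : distortion a σ (L * Lᵀ) L α = (∫⁻ w : Fin a → Fin n → ℝ, ENNReal.ofReal
      (∑ r, ∑ i, (α i * L i i) ^ 2 * roundErrSq (rowArg L α (w r) i)) ∂weightLaw a n σ) /
        ((n : ℝ≥0∞) * (a : ℝ≥0∞)) := by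
    unfold distortion
    congr 1
    exact lintegral_congr fun w => congrArg _ (trace_error hL hα' hLd (Matrix.of w))
  rw [hdist, ← ofReal_integral_eq_lintegral_ofReal
    (integrable_finsetSum _ fun r _ => integrable_finsetSum _ fun i _ => hI i r)
    (ae_of_all _ fun w => Finset.sum_nonneg fun r _ => Finset.sum_nonneg fun i _ =>
      mul_nonneg (sq_nonneg _) (roundErrSq_nonneg _)),
    integral_finsetSum _ (fun r _ => integrable_finsetSum _ fun i _ => hI i r),
    ofReal_div_natCast_mul hn ha]
  congr 1
  have : ∀ r : Fin a, ∫ w : Fin a → Fin n → ℝ, ∑ i,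
      (α i * L i i) ^ 2 * roundErrSq (rowArg L α (w r) i) ∂weightLaw a n σ
        = ∑ i, (α i * L i i) ^ 2 * meanRoundErr σ L α i := fun r => by
    rw [integral_finsetSum _ fun i _ => hI i r]
    exact Finset.sum_congr rfl fun i _ => hval i r
  rw [Finset.sum_congr rfl fun r _ => this r, Finset.sum_const, Finset.card_univ, Fintype.card_fin,
    nsmul_eq_mul]
  have : (a : ℝ) ≠ 0 := by positivity
  field_simp

/-- No feedback reaches the last column. Its error is used to show that a small distortion forces a
small `α`. -/
theorem ofReal_sq_mul_meanRoundErr_of_last (i : Fin n) (hi : ∀ k, k ≤ i) :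
    ENNReal.ofReal (α i ^ 2 * meanRoundErr σ L α i)
      = ∫⁻ y, ENNReal.ofReal (α i ^ 2 * roundErrSq (y / α i)) ∂gaussianReal 0 (σ ^ 2) := by
  have harg : ∀ x, rowArg L α x i = x i / α i := by
    intro x
    have : Finset.Ioi i = ∅ := by
      ext k; simpa using hi k
    simp [rowArg, feedback, this]
  have hmeas : Measurable fun y : ℝ => roundErrSq (y / α i) :=
    measurable_roundErrSq.comp (measurable_id.div_const _)
  simp only [ENNReal.ofReal_mul (sq_nonneg (α i))]
  rw [lintegral_const_mul _ hmeas.ennreal_ofReal, ← lintegral_roundErrSq_rowArg hL hα hLd i]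
  simp only [harg]
  congr 1
  exact (measurePreserving_eval (fun _ : Fin n => gaussianReal 0 (σ ^ 2)) i).lintegral_comp
    hmeas.ennreal_ofReal

end

end Bounds

/-! ### Column rates: converse and mismatched coding -/

theorem summable_measureReal_singleton {A : Type*} [MeasurableSpace A] [Countable A]
    [MeasurableSingletonClass A] (ν : Measure A) [IsProbabilityMeasure ν] :
    Summable (fun z => ν.real {z}) ∧ ∑' z, ν.real {z} = 1 := by
  have h : ∑' z, ν {z} = 1 := by
    have := Measure.tsum_indicator_apply_singleton ν Set.univ MeasurableSet.univ
    simpa using this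
  refine ⟨ENNReal.summable_toReal (by rw [h]; exact ENNReal.one_ne_top), ?_⟩
  simp only [Measure.real]
  rw [← ENNReal.tsum_toReal_eq fun z => measure_ne_top _ _, h, ENNReal.toReal_one]

theorem lintegral_pi_prod {ι : Type*} [Fintype ι] {X : ι → Type*} [∀ i, MeasurableSpace (X i)]
    (μ : ∀ i, Measure (X i)) [∀ i, IsProbabilityMeasure (μ i)] (f : ∀ i, X i → ℝ≥0∞)
    (hf : ∀ i, Measurable (f i)) :
    ∫⁻ x, ∏ i, f i (x i) ∂Measure.pi μ = ∏ i, ∫⁻ y, f i y ∂μ i := by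
  refine (lintegral_prod_eq_prod_lintegral_of_indepFun Finset.univ
    (fun i (x : ∀ i, X i) => f i (x i)) (iIndepFun_pi fun i => (hf i).aemeasurable)
    fun i => (hf i).comp (measurable_pi_apply i)).trans ?_
  exact Finset.prod_congr rfl fun i _ => (measurePreserving_eval μ i).lintegral_comp (hf i)

section Bounds

variable {a n : ℕ} {σ : ℝ≥0} {L : Matrix (Fin n) (Fin n) ℝ} {α : Fin n → ℝ}

/-- The differential entropy of `N(0, σ²)`, in bits. -/
def gaussianEntropy (σ : ℝ≥0) : ℝ := 1 / 2 * Real.logb 2 (2 * Real.pi * Real.exp 1 * σ ^ 2)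

variable (hL : ∀ i j : Fin n, i < j → L i j = 0) (hα : ∀ i, 0 < α i) (hLd : ∀ i, L i i ≠ 0)
include hL hα hLd

theorem setLIntegral_rowIdx_le (hσ : 0 < σ) (i : Fin n) (z : ℤ) :
    ∫⁻ x, ((fun x => rowIdx L α x i) ⁻¹' {z}).indicator
      (fun x => ENNReal.ofReal (gaussianPDFReal 0 (σ ^ 2) (x i))⁻¹) x ∂rowLaw n σ
      ≤ ENNReal.ofReal (α i) := by
  have hv : σ ^ 2 ≠ 0 := (pow_pos hσ 2).ne'
  have hα' : ∀ i, α i ≠ 0 := fun i => (hα i).ne'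
  have hms : MeasurableSet ((fun x => rowIdx L α x i) ⁻¹' {z}) :=
    measurable_rowIdx hL hα' hLd i (measurableSet_singleton z)
  have hφm : Measurable fun x : Fin n → ℝ =>
      ENNReal.ofReal (gaussianPDFReal 0 (σ ^ 2) (x i))⁻¹ :=
    ((measurable_gaussianPDFReal 0 (σ ^ 2)).comp (measurable_pi_apply i)).inv.ennreal_ofReal
  refine lintegral_pi_le_of_update (hφm.indicator hms) i fun x => ?_
  have hms' : MeasurableSet ((fun y : ℝ =>
      round (y / α i + feedback L α x (rowIdx L α x) i)) ⁻¹' {z}) :=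
    (measurable_round_real.comp (by fun_prop)) (measurableSet_singleton z)
  rw [← volume_preimage_round_div_add (hα i) (feedback L α x (rowIdx L α x) i) z,
    ← setLIntegral_inv_gaussianPDFReal hv hms', ← lintegral_indicator hms']
  refine le_of_eq (lintegral_congr fun y => ?_)
  simp only [Set.indicator, Set.mem_preimage, Set.mem_singleton_iff, Function.update_self,
    rowIdx_eq_round hL hα' hLd, rowArg_update hL hα' hLd]

/-- `le_entropyCodedLength` is applied with `ψ` the Gaussian density of the unquantized column. The
integral over a level set factors over the rows, each factor being at most `α i`, hence `β = α i ^
a`. -/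
theorem le_entropyCodedLength_column (hσ : 0 < σ) (i : Fin n) :
    ENNReal.ofReal (a * (gaussianEntropy σ - Real.logb 2 (α i)))
      ≤ entropyCodedLength (weightLaw a n σ)
        (fun w => fun r : Fin a => quantIdx L α (Matrix.of w) r i) := by
  have hv : σ ^ 2 ≠ 0 := (pow_pos hσ 2).ne'
  have hα' : ∀ i, α i ≠ 0 := fun i => (hα i).ne'
  have hX : (fun w : Fin a → Fin n → ℝ => fun r : Fin a => quantIdx L α (Matrix.of w) r i)
      = fun w r => rowIdx L α (w r) i := by
    funext w r
    exact quantIdx_eq_rowIdx hL hα' hLd (Matrix.of w) r i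
  rw [hX]
  set φ := gaussianPDFReal 0 (σ ^ 2) with hφ
  have hφ0 : ∀ x, 0 < φ x := fun x => gaussianPDFReal_pos 0 _ x hv
  have hIφ : ∀ r : Fin a, Integrable (fun w : Fin a → Fin n → ℝ => Real.logb 2 (φ (w r i)))
      (weightLaw a n σ) := fun r =>
    integrable_comp_eval (μ := fun _ : Fin a => rowLaw n σ) (i := r)
      (f := fun x => Real.logb 2 (φ (x i)))
      (integrable_comp_eval (μ := fun _ : Fin n => gaussianReal 0 (σ ^ 2)) (i := i)
        (integrable_logb_gaussianPDFReal hv))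
  have hlogprod : ∀ w : Fin a → Fin n → ℝ,
      Real.logb 2 (∏ r, φ (w r i)) = ∑ r, Real.logb 2 (φ (w r i)) := fun w =>
    Real.logb_prod _ _ fun r _ => (hφ0 _).ne'
  have hint : ∫ w : Fin a → Fin n → ℝ, Real.logb 2 (∏ r, φ (w r i)) ∂weightLaw a n σ
      = -(a * gaussianEntropy σ) := by
    simp only [hlogprod]
    rw [integral_finsetSum _ fun r _ => hIφ r]
    have : ∀ r : Fin a, ∫ w : Fin a → Fin n → ℝ, Real.logb 2 (φ (w r i)) ∂weightLaw a n σ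
        = -gaussianEntropy σ := fun r => by
      rw [weightLaw_eq, integral_comp_eval (μ := fun _ : Fin a => rowLaw n σ) (i := r)
        (f := fun x => Real.logb 2 (φ (x i)))
        (integrable_comp_eval (μ := fun _ : Fin n => gaussianReal 0 (σ ^ 2)) (i := i)
          (integrable_logb_gaussianPDFReal hv)).aestronglyMeasurable, rowLaw,
        integral_comp_eval (μ := fun _ : Fin n => gaussianReal 0 (σ ^ 2)) (i := i)
          (integrable_logb_gaussianPDFReal hv).aestronglyMeasurable,
        integral_logb_gaussianPDFReal hv, gaussianEntropy]
      simp
    simp [this]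
  have key := le_entropyCodedLength (weightLaw a n σ)
    (fun w : Fin a → Fin n → ℝ => fun r => rowIdx L α (w r) i)
    (fun z => measurable_pi_lambda _ (fun r => (measurable_rowIdx hL hα' hLd i).comp
      (measurable_pi_apply r)) (measurableSet_singleton z))
    (fun w => ∏ r, φ (w r i))
    (Finset.measurable_prod _ fun r _ => (measurable_gaussianPDFReal 0 (σ ^ 2)).comp
      ((measurable_pi_apply i).comp (measurable_pi_apply r)))
    (fun w => Finset.prod_pos fun r _ => hφ0 _)
    (by simp only [hlogprod]; exact integrable_finsetSum _ fun r _ => hIφ r)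
    (α i ^ a) (pow_pos (hα i) a) fun z => ?_
  · rw [hint, Real.logb_pow] at key
    refine le_trans (ENNReal.ofReal_le_ofReal (le_of_eq ?_)) key
    ring
  · have hms : MeasurableSet ((fun (w : Fin a → Fin n → ℝ) r => rowIdx L α (w r) i) ⁻¹' {z}) :=
      measurable_pi_lambda _ (fun r => (measurable_rowIdx hL hα' hLd i).comp
        (measurable_pi_apply r)) (measurableSet_singleton z)
    rw [← lintegral_indicator hms]
    calc _ = ∫⁻ w : Fin a → Fin n → ℝ, ∏ r, ((fun x => rowIdx L α x i) ⁻¹' {z r}).indicator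
          (fun x => ENNReal.ofReal (φ (x i))⁻¹) (w r) ∂Measure.pi fun _ => rowLaw n σ := by
          refine lintegral_congr fun w => ?_
          by_cases hw : (fun r => rowIdx L α (w r) i) = z
          · rw [Set.indicator_of_mem (by exact hw), ← Finset.prod_inv_distrib,
              ENNReal.ofReal_prod_of_nonneg fun r _ => (inv_pos.2 (hφ0 _)).le]
            refine Finset.prod_congr rfl fun r _ => ?_
            rw [Set.indicator_of_mem (by exact congrFun hw r)]
          · rw [Set.indicator_of_notMem (by exact hw)]
            obtain ⟨r, hr⟩ := Function.ne_iff.1 hw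
            rw [Finset.prod_eq_zero (Finset.mem_univ r)]
            exact Set.indicator_of_notMem (by exact hr) _
      _ = ∏ r, ∫⁻ x, ((fun x => rowIdx L α x i) ⁻¹' {z r}).indicator
          (fun x => ENNReal.ofReal (φ (x i))⁻¹) x ∂rowLaw n σ :=
          lintegral_pi_prod (fun _ : Fin a => rowLaw n σ) _ fun r => Measurable.indicator
            (((measurable_gaussianPDFReal 0 (σ ^ 2)).comp
              (measurable_pi_apply i)).inv.ennreal_ofReal)
            (measurable_rowIdx hL hα' hLd i (measurableSet_singleton _))
      _ ≤ ∏ _r : Fin a, ENNReal.ofReal (α i) :=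
          Finset.prod_le_prod' fun r _ => setLIntegral_rowIdx_le hL hα hLd hσ i (z r)
      _ = ENNReal.ofReal (α i ^ a) := by
          rw [Finset.prod_const, Finset.card_univ, Fintype.card_fin,
            ENNReal.ofReal_pow (hα i).le]

theorem le_rate (hσ : 0 < σ) (hn : 0 < n) (ha : 0 < a) :
    ENNReal.ofReal ((1 / n) * ∑ i, (gaussianEntropy σ - Real.logb 2 (α i)))
      ≤ rate a σ L α := by
  have h := (ofReal_sum_le_sum_ofReal Finset.univ
    (fun i => a * (gaussianEntropy σ - Real.logb 2 (α i)))).trans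
    (Finset.sum_le_sum fun i _ => le_entropyCodedLength_column (a := a) hL hα hLd hσ i)
  refine le_trans (le_of_eq ?_) (ENNReal.div_le_div_right h _)
  rw [ofReal_div_natCast_mul hn ha, ← Finset.mul_sum]
  congr 1
  have : (a : ℝ) ≠ 0 := by positivity
  field_simp

/-- A bound for the excess of the rate in column `i` over its high-resolution value, in terms of
the spacing `α i` and a bound `K` for the quantization error. -/
def rateExcess (σ : ℝ≥0) (s K : ℝ) : ℝ :=
  (s ^ 2 / 8 + (K * σ ^ 2 + K ^ 2 + K) / 2) / (σ ^ 2 * Real.log 2)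

omit hL hα hLd in
theorem gaussianEntropy_eq (hσ : 0 < σ) :
    gaussianEntropy σ = 1 / 2 * Real.logb 2 (2 * Real.pi * σ ^ 2) + 1 / (2 * Real.log 2) := by
  have hl : 0 < Real.log 2 := Real.log_pos (by norm_num)
  have hσ' : (0 : ℝ) < σ := hσ
  rw [gaussianEntropy, show 2 * Real.pi * Real.exp 1 * (σ : ℝ) ^ 2
    = 2 * Real.pi * σ ^ 2 * Real.exp 1 by ring, Real.logb_mul (by positivity) (by positivity)]
  simp only [Real.logb, Real.log_exp]
  field_simp

theorem entropyCodedLength_column_le (hσ : 0 < σ) (i : Fin n) {K : ℝ}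
    (hK : ∀ x, |x i - α i * rowIdx L α x i| ≤ K) :
    entropyCodedLength (weightLaw a n σ)
        (fun w => fun r : Fin a => quantIdx L α (Matrix.of w) r i)
      ≤ ENNReal.ofReal (2 + a * (gaussianEntropy σ - Real.logb 2 (α i)
          + rateExcess σ (α i) K)) := by
  have hv : σ ^ 2 ≠ 0 := (pow_pos hσ 2).ne'
  have hσ' : (0 : ℝ) < σ := hσ
  have hl : 0 < Real.log 2 := Real.log_pos (by norm_num)
  have hα' : ∀ i, α i ≠ 0 := fun i => (hα i).ne'
  have hK0 : 0 ≤ K := (abs_nonneg _).trans (hK 0)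
  have hX : (fun w : Fin a → Fin n → ℝ => fun r : Fin a => quantIdx L α (Matrix.of w) r i)
      = fun w r => rowIdx L α (w r) i := by
    funext w r
    exact quantIdx_eq_rowIdx hL hα' hLd (Matrix.of w) r i
  rw [hX]
  -- The code is designed for independent rounded Gaussians, although the actual indices also carry
  -- feedback.
  set ν := roundedGaussian (σ ^ 2) (α i) with hν
  set q : (Fin a → ℤ) → ℝ := fun z => (Measure.pi fun _ : Fin a => ν).real {z} with hq
  have hqp : ∀ z, q z = ∏ r, ν.real {z r} := fun z => by
    simp only [hq, Measure.real, Measure.pi_singleton, ENNReal.toReal_prod]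
  have hν0 : ∀ z : ℤ, 0 < ν.real {z} := fun z => (neg_logb_roundedGaussian_le hv (hα i) z).1
  obtain ⟨hs, hs1⟩ := summable_measureReal_singleton (Measure.pi fun _ : Fin a => ν)
  have hq0 : ∀ z, 0 < q z := fun z => by rw [hqp]; exact Finset.prod_pos fun r _ => hν0 _
  refine (entropyCodedLength_le _ _ q hq0 hs hs1.le).trans ?_
  set C := 1 / 2 * Real.logb 2 (2 * Real.pi * σ ^ 2) - Real.logb 2 (α i)
    + α i ^ 2 / (8 * σ ^ 2 * Real.log 2) with hC
  -- A majorant of the code cost that depends on `x i` alone: `α z = x - e` with `|e| ≤ K`, and `2|x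
  -- e| ≤ K (x² + 1)`. Its mean needs only the Gaussian second moment.
  set g : ℝ → ℝ := fun y => C + ((1 + K) * y ^ 2 + (K ^ 2 + K)) / (2 * σ ^ 2 * Real.log 2) with hg
  have hpt : ∀ x : Fin n → ℝ, -Real.logb 2 (ν.real {rowIdx L α x i}) ≤ g (x i) := by
    intro x
    refine (neg_logb_roundedGaussian_le hv (hα i) _).2.trans ?_
    have h1 : (α i * rowIdx L α x i) ^ 2 ≤ (1 + K) * x i ^ 2 + (K ^ 2 + K) := by
      set e := x i - α i * rowIdx L α x i with he
      have h2 : α i * rowIdx L α x i = x i - e := by rw [he]; ring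
      have h3 := abs_le.1 (hK x)
      rw [h2]
      have h4 : e ^ 2 ≤ K ^ 2 := sq_le_sq' h3.1 h3.2
      have h5 : -(2 * x i * e) ≤ K * (x i ^ 2 + 1) := by
        nlinarith [sq_nonneg (x i + 1), sq_nonneg (x i - 1), mul_nonneg (sub_nonneg.2 h3.1)
          (sq_nonneg (x i + 1)), mul_nonneg (sub_nonneg.2 h3.2) (sq_nonneg (x i - 1)),
          mul_nonneg (sub_nonneg.2 h3.1) (sq_nonneg (x i - 1)), mul_nonneg (sub_nonneg.2 h3.2)
          (sq_nonneg (x i + 1))]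
      nlinarith
    have h6 : (α i * rowIdx L α x i) ^ 2 / (2 * σ ^ 2 * Real.log 2)
        ≤ ((1 + K) * x i ^ 2 + (K ^ 2 + K)) / (2 * σ ^ 2 * Real.log 2) := by gcongr
    simp only [hg, hC]
    push_cast
    linarith
  have hgi : Integrable g (gaussianReal 0 (σ ^ 2)) :=
    (integrable_const _).add (((integrable_sq_gaussianReal.const_mul _).add
      (integrable_const _)).div_const _)
  have hgint : ∫ y, g y ∂gaussianReal 0 (σ ^ 2)
      = gaussianEntropy σ - Real.logb 2 (α i) + rateExcess σ (α i) K := by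
    simp only [hg]
    rw [integral_add (g := fun y => ((1 + K) * y ^ 2 + (K ^ 2 + K)) / (2 * σ ^ 2 * Real.log 2))
      (integrable_const _) (((integrable_sq_gaussianReal.const_mul _).add
      (integrable_const _)).div_const _), integral_div,
      integral_add (integrable_sq_gaussianReal.const_mul _) (integrable_const _),
      integral_const_mul, integral_sq_gaussianReal]
    simp only [integral_const, probReal_univ, one_smul, hC, rateExcess, gaussianEntropy_eq hσ]
    push_cast
    field_simp
    ring
  have hgr : ∀ r : Fin a, Integrable (fun w : Fin a → Fin n → ℝ => g (w r i))
      (weightLaw a n σ) := fun r =>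
    integrable_comp_eval (μ := fun _ : Fin a => rowLaw n σ) (i := r) (f := fun x => g (x i))
      (integrable_comp_eval (μ := fun _ : Fin n => gaussianReal 0 (σ ^ 2)) (i := i) hgi)
  have hgrint : ∀ r : Fin a, ∫ w : Fin a → Fin n → ℝ, g (w r i) ∂weightLaw a n σ
      = gaussianEntropy σ - Real.logb 2 (α i) + rateExcess σ (α i) K := fun r => by
    rw [weightLaw_eq, integral_comp_eval (μ := fun _ : Fin a => rowLaw n σ) (i := r)
      (f := fun x => g (x i)) (integrable_comp_eval
        (μ := fun _ : Fin n => gaussianReal 0 (σ ^ 2)) (i := i) hgi).aestronglyMeasurable, rowLaw,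
      integral_comp_eval (μ := fun _ : Fin n => gaussianReal 0 (σ ^ 2)) (i := i)
        hgi.aestronglyMeasurable, hgint]
  have hg0 : ∀ x : Fin n → ℝ, 0 ≤ g (x i) := fun x =>
    le_trans (neg_nonneg.2 (Real.logb_nonpos (by norm_num) (hν0 _).le measureReal_le_one)) (hpt x)
  calc ∫⁻ w : Fin a → Fin n → ℝ,
        ENNReal.ofReal (2 - Real.logb 2 (q fun r => rowIdx L α (w r) i)) ∂weightLaw a n σ
      ≤ ∫⁻ w : Fin a → Fin n → ℝ, ENNReal.ofReal (2 + ∑ r, g (w r i)) ∂weightLaw a n σ := by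
        refine lintegral_mono fun w => ENNReal.ofReal_le_ofReal ?_
        rw [hqp, Real.logb_prod _ _ fun r _ => (hν0 _).ne', sub_eq_add_neg,
          ← Finset.sum_neg_distrib]
        gcongr with r
        exact hpt (w r)
    _ = ENNReal.ofReal (∫ w : Fin a → Fin n → ℝ, (2 + ∑ r, g (w r i)) ∂weightLaw a n σ) :=
        (ofReal_integral_eq_lintegral_ofReal
          ((integrable_const _).add (integrable_finsetSum _ fun r _ => hgr r))
          (ae_of_all _ fun w => add_nonneg zero_le_two
            (Finset.sum_nonneg fun r _ => hg0 (w r)))).symm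
    _ = _ := by
        rw [integral_add (integrable_const _) (integrable_finsetSum _ fun r _ => hgr r),
          integral_finsetSum _ fun r _ => hgr r]
        simp [hgrint, mul_add]

theorem rate_le (hσ : 0 < σ) (hn : 0 < n) (ha : 0 < a) {K : ℝ}
    (hK : ∀ x i, |x i - α i * rowIdx L α x i| ≤ K)
    (h0 : ∀ i, Real.logb 2 (α i) ≤ gaussianEntropy σ) :
    rate a σ L α ≤ ENNReal.ofReal (2 / a +
      (1 / n) * ∑ i, (gaussianEntropy σ - Real.logb 2 (α i) + rateExcess σ (α i) K)) := by
  have hK0 : 0 ≤ K := (abs_nonneg _).trans (hK 0 ⟨0, hn⟩)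
  have hl : 0 < Real.log 2 := Real.log_pos (by norm_num)
  have hex : ∀ i, 0 ≤ rateExcess σ (α i) K := fun i => by
    unfold rateExcess; positivity
  have h := Finset.sum_le_sum fun i (_ : i ∈ Finset.univ) =>
    entropyCodedLength_column_le (a := a) hL hα hLd hσ i fun x => hK x i
  rw [← ENNReal.ofReal_sum_of_nonneg fun i _ => add_nonneg zero_le_two
    (mul_nonneg a.cast_nonneg (by linarith [hex i, h0 i]))] at h
  refine (ENNReal.div_le_div_right h _).trans (le_of_eq ?_)
  rw [ofReal_div_natCast_mul hn ha, Finset.sum_add_distrib, ← Finset.mul_sum]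
  congr 1
  have ha' : (a : ℝ) ≠ 0 := by positivity
  have hn' : (n : ℝ) ≠ 0 := by positivity
  simp only [Finset.sum_const, Finset.card_univ, Fintype.card_fin, nsmul_eq_mul]
  field_simp

end Bounds

/-! ### Waterfilling at small distortion -/

section Waterfilling

variable {n : ℕ} {σ : ℝ≥0} {S L : Matrix (Fin n) (Fin n) ℝ}

/-- Below all `σ² λ_i` every minimum is `τ`, so `τ = D` is a solution. For `τ < D` every minimum is
below `D`, for `τ > D` every one is above, so it is the only one. -/
theorem waterLevel_eq (hn : 0 < n) (hS : S.IsHermitian) {D : ℝ} (hD : 0 < D)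
    (hD' : ∀ i, D < (σ : ℝ) ^ 2 * hS.eigenvalues i) : waterLevel σ hS D = D := by
  have hn' : (0 : ℝ) < n := by exact_mod_cast hn
  have : {τ : ℝ | 0 < τ ∧ D = (1 / (n : ℝ)) * ∑ i, min ((σ : ℝ) ^ 2 * hS.eigenvalues i) τ}
      = {D} := by
    ext τ
    simp only [Set.mem_ofPred_eq, Set.mem_singleton_iff]
    constructor
    · rintro ⟨-, hτ⟩
      have hsum : ∑ i, (min ((σ : ℝ) ^ 2 * hS.eigenvalues i) τ - D) = 0 := by
        rw [Finset.sum_sub_distrib, Finset.sum_const, Finset.card_univ, Fintype.card_fin,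
          nsmul_eq_mul]
        field_simp at hτ
        linarith
      have : Nonempty (Fin n) := ⟨⟨0, hn⟩⟩
      rcases lt_trichotomy τ D with h | h | h
      · have := Finset.sum_neg (s := Finset.univ) (f := fun i =>
          min ((σ : ℝ) ^ 2 * hS.eigenvalues i) τ - D)
          (fun i _ => by have := min_le_right ((σ : ℝ) ^ 2 * hS.eigenvalues i) τ; linarith)
          Finset.univ_nonempty
        linarith
      · exact h
      · have := Finset.sum_pos (s := Finset.univ) (f := fun i =>
          min ((σ : ℝ) ^ 2 * hS.eigenvalues i) τ - D)
          (fun i _ => sub_pos.2 (lt_min (hD' i) h)) Finset.univ_nonempty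
        linarith
    · rintro rfl
      refine ⟨hD, ?_⟩
      rw [Finset.sum_congr rfl fun i _ => min_eq_right (hD' i).le]
      simp only [Finset.sum_const, Finset.card_univ, Fintype.card_fin, nsmul_eq_mul]
      field_simp
  rw [waterLevel, this, csInf_singleton]

theorem diag_ne_zero_of_posDef (hS : S.PosDef) (hL : ∀ i j : Fin n, i < j → L i j = 0)
    (hSL : S = L * Lᵀ) (i : Fin n) : L i i ≠ 0 := by
  have h := hS.det_pos
  rw [hSL, Matrix.det_mul, Matrix.det_transpose,
    Matrix.det_of_isLowerTriangular L (fun i j h => hL i j h)] at h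
  intro hi
  rw [Finset.prod_eq_zero (f := fun i => L i i) (Finset.mem_univ i) hi] at h
  simp at h

theorem eventually_rateWF_eq (hn : 0 < n) (hσ : 0 < σ) (hS : S.PosDef)
    (hL : ∀ i j : Fin n, i < j → L i j = 0) (hSL : S = L * Lᵀ) :
    ∀ᶠ D in 𝓝[>] (0 : ℝ), rateWF σ hS.isHermitian D
      = 1 / 2 * Real.logb 2 ((σ : ℝ) ^ 2) - 1 / 2 * Real.logb 2 D
        + 1 / (2 * n) * ∑ i, Real.logb 2 (L i i ^ 2) := by
  have hn' : (0 : ℝ) < n := by exact_mod_cast hn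
  have hσ' : (0 : ℝ) < σ := hσ
  have hev : ∀ i, 0 < hS.isHermitian.eigenvalues i := fun i => hS.eigenvalues_pos i
  have hLd := diag_ne_zero_of_posDef hS hL hSL
  have hsmall : ∀ᶠ D in 𝓝[>] (0 : ℝ), ∀ i, D < (σ : ℝ) ^ 2 * hS.isHermitian.eigenvalues i := by
    rw [eventually_all]
    intro i
    have hp : 0 < (σ : ℝ) ^ 2 * hS.isHermitian.eigenvalues i := mul_pos (by positivity) (hev i)
    exact nhdsWithin_le_nhds (gt_mem_nhds hp)
  have hdet : ∑ i, Real.logb 2 (hS.isHermitian.eigenvalues i) = ∑ i, Real.logb 2 (L i i ^ 2) := by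
    rw [← Real.logb_prod _ _ fun i _ => (hev i).ne',
      ← Real.logb_prod _ _ fun i _ => pow_ne_zero 2 (hLd i)]
    congr 1
    have h1 := hS.isHermitian.det_eq_prod_eigenvalues
    simp only [RCLike.ofReal_real_eq_id, id] at h1
    rw [← h1]
    conv_lhs => rw [hSL]
    rw [Matrix.det_mul, Matrix.det_transpose,
      Matrix.det_of_isLowerTriangular L (fun i j h => hL i j h), Finset.prod_pow, sq]
  filter_upwards [hsmall, self_mem_nhdsWithin] with D hD hD0
  have hD0' : 0 < D := hD0
  rw [rateWF, waterLevel_eq hn _ hD0' hD]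
  have hterm : ∀ i, (1 / 2 : ℝ) * Real.logb 2 (max 1 ((σ : ℝ) ^ 2 *
      hS.isHermitian.eigenvalues i / D)) = (1 / 2 * Real.logb 2 ((σ : ℝ) ^ 2)
        - 1 / 2 * Real.logb 2 D) + 1 / 2 * Real.logb 2 (hS.isHermitian.eigenvalues i) := by
    intro i
    have := hev i
    rw [max_eq_right (by rw [le_div_iff₀ hD0']; linarith [hD i]),
      Real.logb_div (by positivity) hD0'.ne', Real.logb_mul (by positivity) this.ne']
    ring
  rw [Finset.sum_congr rfl fun i _ => hterm i, Finset.sum_add_distrib, ← Finset.mul_sum, hdet]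
  simp only [Finset.sum_const, Finset.card_univ, Fintype.card_fin, nsmul_eq_mul]
  field_simp

end Waterfilling

/-! ### The high-resolution limit -/

/-- For each `a` take `ε = 1/a`; the inner limits are then squeezed between `c - 1/a` and `c + 3/a`.
-/
theorem hasIteratedLimit_of_bounds {g : ℕ → ℝ → EReal} {c : ℝ}
    (hlow : ∀ a, 0 < a → ∀ ε : ℝ, 0 < ε → ∀ᶠ D in 𝓝[>] (0 : ℝ), ((c - ε : ℝ) : EReal) ≤ g a D)
    (hup : ∀ a, 0 < a → ∀ ε : ℝ, 0 < ε →
      ∀ᶠ D in 𝓝[>] (0 : ℝ), g a D ≤ ((c + 2 / a + ε : ℝ) : EReal)) :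
    HasIteratedLimit g c := by
  have hl : Tendsto (fun a : ℕ => ((c - 1 / a : ℝ) : EReal)) atTop (𝓝 (c : EReal)) := by
    refine (continuous_coe_real_ereal.tendsto c).comp ?_
    simpa using tendsto_const_nhds.sub (tendsto_const_div_atTop_nhds_zero_nat (1 : ℝ))
  have hu : Tendsto (fun a : ℕ => ((c + 2 / a + 1 / a : ℝ) : EReal)) atTop (𝓝 (c : EReal)) := by
    refine (continuous_coe_real_ereal.tendsto c).comp ?_
    simpa using (tendsto_const_nhds.add (tendsto_const_div_atTop_nhds_zero_nat (2 : ℝ))).add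
      (tendsto_const_div_atTop_nhds_zero_nat (1 : ℝ))
  have h1 : ∀ᶠ a : ℕ in atTop, ((c - 1 / a : ℝ) : EReal) ≤ liminf (g a) (𝓝[>] (0 : ℝ)) := by
    filter_upwards [eventually_gt_atTop 0] with a ha
    exact le_liminf_of_le (by isBoundedDefault) (hlow a ha (1 / a) (by positivity))
  have h2 : ∀ᶠ a : ℕ in atTop, limsup (g a) (𝓝[>] (0 : ℝ)) ≤ ((c + 2 / a + 1 / a : ℝ) : EReal) := by
    filter_upwards [eventually_gt_atTop 0] with a ha
    exact limsup_le_of_le (by isBoundedDefault) (hup a ha (1 / a) (by positivity))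
  have h3 : ∀ a : ℕ, liminf (g a) (𝓝[>] (0 : ℝ)) ≤ limsup (g a) (𝓝[>] (0 : ℝ)) :=
    fun a => liminf_le_limsup
  exact ⟨tendsto_of_tendsto_of_tendsto_of_le_of_le' hl hu
      (h1.mono fun a h => h.trans (h3 a)) h2,
    tendsto_of_tendsto_of_tendsto_of_le_of_le' hl hu h1 (h2.mono fun a h => (h3 a).trans h)⟩

section HighResolution

variable {n : ℕ} {σ : ℝ≥0} {S L : Matrix (Fin n) (Fin n) ℝ} {b : Fin n → ℝ}

/-- The mean of the squares of the scaled diagonal entries. -/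
def meanSq (L : Matrix (Fin n) (Fin n) ℝ) (b : Fin n → ℝ) : ℝ :=
  (1 / n) * ∑ i, (b i * L i i) ^ 2

/-- The limiting gap to the waterfilling rate for the spacings `α b_i`. -/
def rateGap (L : Matrix (Fin n) (Fin n) ℝ) (b : Fin n → ℝ) : ℝ :=
  1 / 2 * Real.logb 2 (2 * Real.pi * Real.exp 1 / 12)
    + 1 / 2 * Real.logb 2 (meanSq L b / (∏ i, (b i * L i i) ^ 2) ^ (1 / (n : ℝ)))

theorem meanSq_pos (hn : 0 < n) (hb : ∀ i, 0 < b i) (hLd : ∀ i, L i i ≠ 0) : 0 < meanSq L b := by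
  have : Nonempty (Fin n) := ⟨⟨0, hn⟩⟩
  have hn' : (0 : ℝ) < n := by exact_mod_cast hn
  refine mul_pos (by positivity) (Finset.sum_pos (fun i _ => ?_) Finset.univ_nonempty)
  have := mul_ne_zero (hb i).ne' (hLd i)
  positivity

/-- Here `t` stands for the mean rounding error and `α² = D / (meanSq L b * t)`. The last bracket is
the waterfilling rate, and the correction `½ log₂ (12 t)` vanishes at `t = 1/12`. -/
theorem gaussianEntropy_sub_eq (hn : 0 < n) (hσ : 0 < σ) (hb : ∀ i, 0 < b i)
    (hLd : ∀ i, L i i ≠ 0) {D t : ℝ} (hD : 0 < D) (ht : 0 < t) :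
    gaussianEntropy σ - 1 / 2 * Real.logb 2 (D / (meanSq L b * t))
        - (1 / n) * ∑ i, Real.logb 2 (b i)
      = rateGap L b + 1 / 2 * Real.logb 2 (12 * t)
        + (1 / 2 * Real.logb 2 ((σ : ℝ) ^ 2) - 1 / 2 * Real.logb 2 D
          + 1 / (2 * n) * ∑ i, Real.logb 2 (L i i ^ 2)) := by
  have hn' : (0 : ℝ) < n := by exact_mod_cast hn
  have hσ' : (0 : ℝ) < σ := hσ
  have hm := meanSq_pos hn hb hLd
  have hne : ∀ i, (b i * L i i) ^ 2 ≠ 0 := fun i => pow_ne_zero 2 (mul_ne_zero (hb i).ne' (hLd i))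
  have hP : 0 < ∏ i, (b i * L i i) ^ 2 := Finset.prod_pos fun i _ =>
    lt_of_le_of_ne (sq_nonneg _) (hne i).symm
  have hlogP : Real.logb 2 (∏ i, (b i * L i i) ^ 2)
      = 2 * ∑ i, Real.logb 2 (b i) + ∑ i, Real.logb 2 (L i i ^ 2) := by
    rw [Real.logb_prod _ _ fun i _ => hne i, Finset.mul_sum, ← Finset.sum_add_distrib]
    refine Finset.sum_congr rfl fun i _ => ?_
    rw [mul_pow, Real.logb_mul (pow_ne_zero 2 (hb i).ne') (pow_ne_zero 2 (hLd i)),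
      Real.logb_pow]
    norm_num
  rw [rateGap, gaussianEntropy, Real.logb_div hD.ne' (by positivity),
    Real.logb_mul hm.ne' ht.ne', Real.logb_div hm.ne' (by positivity),
    Real.logb_rpow_eq_mul_logb_of_pos hP, hlogP, Real.logb_mul (by norm_num) ht.ne',
    Real.logb_div (by positivity) (by norm_num), Real.logb_mul (by positivity) (by positivity)]
  field_simp
  ring

theorem sum_gaussianEntropy_sub (hn : 0 < n) (hb : ∀ i, 0 < b i) {α : ℝ} (hα : 0 < α) :
    (1 / n) * ∑ i, (gaussianEntropy σ - Real.logb 2 (α * b i))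
      = gaussianEntropy σ - Real.logb 2 α - (1 / n) * ∑ i, Real.logb 2 (b i) := by
  have hn' : (0 : ℝ) < n := by exact_mod_cast hn
  have : ∀ i, gaussianEntropy σ - Real.logb 2 (α * b i)
      = (gaussianEntropy σ - Real.logb 2 α) - Real.logb 2 (b i) := fun i => by
    rw [Real.logb_mul hα.ne' (hb i).ne']; ring
  simp only [this, Finset.sum_sub_distrib, Finset.sum_const, Finset.card_univ, Fintype.card_fin,
    nsmul_eq_mul]
  field_simp

theorem eventually_abs_meanRoundErr_sub_le (hσ : 0 < σ)
    (hL : ∀ i j : Fin n, i < j → L i j = 0) (hLd : ∀ i, L i i ≠ 0) (hb : ∀ i, 0 < b i)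
    {η : ℝ} (hη : 0 < η) :
    ∀ᶠ α in 𝓝[>] (0 : ℝ), ∀ i, |meanRoundErr σ L (fun i => α * b i) i - 1 / 12| ≤ η := by
  have h : ∀ i, Tendsto (fun α : ℝ => (α * b i * (1 + (σ : ℝ) ^ 2) + (α * b i) ^ 2) / (σ : ℝ) ^ 2)
      (𝓝[>] 0) (𝓝 0) := fun i => by
    have : Continuous fun α : ℝ =>
        (α * b i * (1 + (σ : ℝ) ^ 2) + (α * b i) ^ 2) / (σ : ℝ) ^ 2 := by fun_prop
    have h := this.tendsto 0
    simp only [zero_mul, ne_eq, OfNat.ofNat_ne_zero, not_false_eq_true, zero_pow, add_zero,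
      zero_div] at h
    exact h.mono_left nhdsWithin_le_nhds
  have h' : ∀ᶠ α in 𝓝[>] (0 : ℝ), ∀ i,
      (α * b i * (1 + (σ : ℝ) ^ 2) + (α * b i) ^ 2) / (σ : ℝ) ^ 2 < η :=
    eventually_all.2 fun i => (h i).eventually (gt_mem_nhds hη)
  filter_upwards [h', self_mem_nhdsWithin] with α hα hα0 i
  exact (abs_meanRoundErr_sub_le hL (fun i => mul_pos hα0 (hb i)) hLd hσ i).trans (hα i).le

theorem eventually_le_rateAt_sub (hn : 0 < n) (hσ : 0 < σ) (hS : S.PosDef)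
    (hL : ∀ i j : Fin n, i < j → L i j = 0) (hSL : S = L * Lᵀ) (hb : ∀ i, 0 < b i)
    {a : ℕ} (ha : 0 < a) {ε : ℝ} (hε : 0 < ε) :
    ∀ᶠ D in 𝓝[>] (0 : ℝ), ((rateGap L b - ε : ℝ) : EReal) ≤
      ((rateAt a σ S L (fun α i => α * b i) D : ℝ≥0∞) : EReal)
        - ((rateWF σ hS.isHermitian D : ℝ) : EReal) := by
  have hn' : (0 : ℝ) < n := by exact_mod_cast hn
  have hLd := diag_ne_zero_of_posDef hS hL hSL
  have hm := meanSq_pos hn hb hLd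
  have hv : σ ^ 2 ≠ 0 := (pow_pos hσ 2).ne'
  obtain ⟨η, hη0, hη1, hη⟩ : ∃ η : ℝ, 0 < η ∧ η < 1 / 12 ∧
      -ε ≤ 1 / 2 * Real.logb 2 (12 * (1 / 12 - η)) := by
    have hc : ContinuousAt (fun η : ℝ => 1 / 2 * Real.logb 2 (12 * (1 / 12 - η))) 0 := by
      simp only [Real.logb]
      refine ContinuousAt.mul continuousAt_const (ContinuousAt.div_const (ContinuousAt.log
        (by fun_prop) (by norm_num)) _)
    have h0 : -ε < (fun η : ℝ => 1 / 2 * Real.logb 2 (12 * (1 / 12 - η))) 0 := by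
      norm_num [hε]
    have h1 : ∀ᶠ η in 𝓝[>] (0 : ℝ), -ε < 1 / 2 * Real.logb 2 (12 * (1 / 12 - η)) :=
      nhdsWithin_le_nhds (hc.eventually (lt_mem_nhds h0))
    have h2 : ∀ᶠ η in 𝓝[>] (0 : ℝ), η < 1 / 12 :=
      nhdsWithin_le_nhds (gt_mem_nhds (by norm_num))
    obtain ⟨η, h3, h4, h5⟩ := (h1.and (h2.and self_mem_nhdsWithin)).exists
    exact ⟨η, h5, h4, le_of_lt h3⟩
  obtain ⟨α₀, hα₀, hsmall⟩ := mem_nhdsGT_iff_exists_Ioo_subset.1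
    (eventually_abs_meanRoundErr_sub_le hσ hL hLd hb hη0)
  have hα₀' : 0 < α₀ := hα₀
  set k : Fin n := ⟨n - 1, by omega⟩ with hk
  have hklast : ∀ j : Fin n, j ≤ k := fun j => by
    rw [Fin.le_def]; simp only [hk]; omega
  obtain ⟨κ, hκ, hlow⟩ := exists_pos_le_lintegral_roundErrSq hv (mul_pos hα₀' (hb k))
  have hDsmall : ∀ᶠ D in 𝓝[>] (0 : ℝ), D < 1 / n * (L k k ^ 2 * κ) :=
    nhdsWithin_le_nhds (gt_mem_nhds (mul_pos (by positivity)
      (mul_pos (lt_of_le_of_ne (sq_nonneg _) (pow_ne_zero 2 (hLd k)).symm) hκ)))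
  filter_upwards [hDsmall, self_mem_nhdsWithin, eventually_rateWF_eq hn hσ hS hL hSL]
    with D hD hD0 hWF
  have hD0' : 0 < D := hD0
  set V := gaussianEntropy σ - 1 / 2 * Real.logb 2 (D / (meanSq L b * (1 / 12 - η)))
        - (1 / n) * ∑ i, Real.logb 2 (b i) with hV
  have hrate : ENNReal.ofReal V ≤ rateAt a σ S L (fun α i => α * b i) D := by
    refine le_iInf fun α => le_iInf fun hα => le_iInf fun hdist => ?_
    have hαb : ∀ i, 0 < α * b i := fun i => mul_pos hα (hb i)
    rw [hSL, distortion_eq hL hαb hLd hn ha, ENNReal.ofReal_le_ofReal_iff hD0'.le] at hdist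
    have hterm : ∀ i, 0 ≤ (α * b i * L i i) ^ 2 * meanRoundErr σ L (fun i => α * b i) i :=
      fun i => mul_nonneg (sq_nonneg _) (meanRoundErr_nonneg i)
    -- The infimum runs over all `α`, so large ones must be excluded: for `α ≥ α₀` the last column
    -- alone already exceeds the distortion `D`.
    have hαlt : α < α₀ := by
      by_contra hge
      have h1 := hlow (α * b k) (mul_le_mul_of_nonneg_right (not_lt.1 hge) (hb k).le)
      rw [← ofReal_sq_mul_meanRoundErr_of_last hL hαb hLd k hklast,
        ENNReal.ofReal_le_ofReal_iff (mul_nonneg (sq_nonneg _) (meanRoundErr_nonneg k))] at h1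
      have h2 := Finset.single_le_sum (fun i _ => hterm i) (Finset.mem_univ k)
      have h3 : L k k ^ 2 * κ ≤
          (α * b k * L k k) ^ 2 * meanRoundErr σ L (fun i => α * b i) k := by
        rw [mul_pow]; nlinarith [sq_nonneg (L k k)]
      have h4 : 1 / (n : ℝ) * (L k k ^ 2 * κ) ≤ 1 / n * ∑ i, (α * b i * L i i) ^ 2 *
          meanRoundErr σ L (fun i => α * b i) i := by
        gcongr; exact h3.trans h2
      linarith
    have hround : ∀ i, 1 / 12 - η ≤ meanRoundErr σ L (fun i => α * b i) i := fun i => by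
      have := (abs_le.1 (hsmall ⟨hα, hαlt⟩ i)).1
      linarith
    have hsq : α ^ 2 * (meanSq L b * (1 / 12 - η)) ≤ D := by
      refine le_trans ?_ hdist
      have : α ^ 2 * (meanSq L b * (1 / 12 - η))
          = 1 / n * ∑ i, (α * b i * L i i) ^ 2 * (1 / 12 - η) := by
        rw [meanSq, ← Finset.sum_mul]
        have : ∀ i, (α * b i * L i i) ^ 2 = α ^ 2 * (b i * L i i) ^ 2 := fun i => by ring
        simp only [this, ← Finset.mul_sum]
        ring
      rw [this]
      gcongr with i
      exact hround i
    have hpos : 0 < meanSq L b * (1 / 12 - η) := mul_pos hm (by linarith)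
    have hlogα : Real.logb 2 α ≤ 1 / 2 * Real.logb 2 (D / (meanSq L b * (1 / 12 - η))) := by
      have h1 := Real.logb_le_logb_of_le (b := 2) (by norm_num) (pow_pos hα 2)
        ((le_div_iff₀ hpos).2 hsq)
      rw [Real.logb_pow] at h1
      push_cast at h1
      linarith
    refine le_trans (ENNReal.ofReal_le_ofReal ?_) (le_rate hL hαb hLd hσ hn ha)
    rw [sum_gaussianEntropy_sub hn hb hα]
    linarith
  have hVeq := gaussianEntropy_sub_eq hn hσ hb hLd hD0' (t := 1 / 12 - η) (by linarith)
  rw [← hV, ← hWF] at hVeq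
  have h1 : (V : EReal) ≤ ((rateAt a σ S L (fun α i => α * b i) D : ℝ≥0∞) : EReal) := by
    refine le_trans ?_ (EReal.coe_ennreal_le_coe_ennreal_iff.2 hrate)
    rw [EReal.coe_ennreal_ofReal]
    exact EReal.coe_le_coe_iff.2 (le_max_left _ _)
  calc ((rateGap L b - ε : ℝ) : EReal)
      ≤ ((V - rateWF σ hS.isHermitian D : ℝ) : EReal) := EReal.coe_le_coe_iff.2 (by linarith)
    _ = (V : EReal) - ((rateWF σ hS.isHermitian D : ℝ) : EReal) := EReal.coe_sub _ _
    _ ≤ _ := EReal.sub_le_sub h1 le_rfl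

theorem eventually_rateAt_sub_le (hn : 0 < n) (hσ : 0 < σ) (hS : S.PosDef)
    (hL : ∀ i j : Fin n, i < j → L i j = 0) (hSL : S = L * Lᵀ) (hb : ∀ i, 0 < b i)
    {a : ℕ} (ha : 0 < a) {ε : ℝ} (hε : 0 < ε) :
    ∀ᶠ D in 𝓝[>] (0 : ℝ), ((rateAt a σ S L (fun α i => α * b i) D : ℝ≥0∞) : EReal)
        - ((rateWF σ hS.isHermitian D : ℝ) : EReal) ≤ ((rateGap L b + 2 / a + ε : ℝ) : EReal) := by
  have hn' : (0 : ℝ) < n := by exact_mod_cast hn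
  have hσ' : (0 : ℝ) < σ := hσ
  have hLd := diag_ne_zero_of_posDef hS hL hSL
  have hm := meanSq_pos hn hb hLd
  obtain ⟨η, hη0, hη⟩ : ∃ η : ℝ, 0 < η ∧
      1 / 2 * Real.logb 2 (12 * (1 / 12 + η)) ≤ ε / 2 := by
    have hc : ContinuousAt (fun η : ℝ => 1 / 2 * Real.logb 2 (12 * (1 / 12 + η))) 0 := by
      simp only [Real.logb]
      refine ContinuousAt.mul continuousAt_const (ContinuousAt.div_const (ContinuousAt.log
        (by fun_prop) (by norm_num)) _)
    have h0 : (fun η : ℝ => 1 / 2 * Real.logb 2 (12 * (1 / 12 + η))) 0 < ε / 2 := by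
      norm_num [hε]
    have h1 : ∀ᶠ η in 𝓝[>] (0 : ℝ), 1 / 2 * Real.logb 2 (12 * (1 / 12 + η)) < ε / 2 :=
      nhdsWithin_le_nhds (hc.eventually (gt_mem_nhds h0))
    obtain ⟨η, h3, h5⟩ := (h1.and self_mem_nhdsWithin).exists
    exact ⟨η, h5, le_of_lt h3⟩
  -- Summing over `i` as well lets `α * K` bound the error of every column at once.
  set K : ℝ := ∑ i, ∑ k, b k * |L k k| * |L⁻¹ k i| with hK
  have hexc : ∀ᶠ α in 𝓝[>] (0 : ℝ),
      (1 / n) * ∑ i, rateExcess σ (α * b i) (α * K) < ε / 2 := by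
    have hc : Continuous fun α : ℝ => (1 / (n : ℝ)) * ∑ i, rateExcess σ (α * b i) (α * K) := by
      unfold rateExcess
      fun_prop
    refine nhdsWithin_le_nhds (hc.continuousAt.eventually (gt_mem_nhds ?_))
    simp [rateExcess, hε]
  have hent : ∀ᶠ α in 𝓝[>] (0 : ℝ), ∀ i, Real.logb 2 (α * b i) ≤ gaussianEntropy σ := by
    rw [eventually_all]
    intro i
    have hc : Continuous fun α : ℝ => α * b i := by fun_prop
    have h : ∀ᶠ α in 𝓝[>] (0 : ℝ), α * b i < 2 ^ gaussianEntropy σ :=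
      nhdsWithin_le_nhds (hc.continuousAt.eventually (gt_mem_nhds (by simp; positivity)))
    filter_upwards [h, self_mem_nhdsWithin] with α h hα
    exact (Real.logb_le_iff_le_rpow (by norm_num) (mul_pos hα (hb i))).2 h.le
  have hpos : 0 < meanSq L b * (1 / 12 + η) := mul_pos hm (by linarith)
  have htend : Tendsto (fun D : ℝ => √(D / (meanSq L b * (1 / 12 + η)))) (𝓝[>] 0) (𝓝[>] 0) := by
    refine tendsto_nhdsWithin_iff.2 ⟨?_, ?_⟩
    · have hc : Continuous fun D : ℝ => √(D / (meanSq L b * (1 / 12 + η))) := by fun_prop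
      have := hc.tendsto 0
      simp only [zero_div, Real.sqrt_zero] at this
      exact this.mono_left nhdsWithin_le_nhds
    · filter_upwards [self_mem_nhdsWithin] with D hD
      exact Real.sqrt_pos.2 (div_pos hD hpos)
  filter_upwards [htend.eventually (hexc.and (hent.and
    (eventually_abs_meanRoundErr_sub_le hσ hL hLd hb hη0))), self_mem_nhdsWithin,
    eventually_rateWF_eq hn hσ hS hL hSL] with D hD hD0 hWF
  obtain ⟨hDexc, hDent, hDround⟩ := hD
  have hD0' : 0 < D := hD0
  -- This choice would give distortion exactly `D` if every mean rounding error were `1/12 + η`, an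
  -- upper bound for them, so it is admissible.
  set α := √(D / (meanSq L b * (1 / 12 + η))) with hα
  have hα0 : 0 < α := Real.sqrt_pos.2 (div_pos hD0' hpos)
  have hαsq : α ^ 2 = D / (meanSq L b * (1 / 12 + η)) := Real.sq_sqrt (div_pos hD0' hpos).le
  have hαb : ∀ i, 0 < α * b i := fun i => mul_pos hα0 (hb i)
  have hlogα : Real.logb 2 α = 1 / 2 * Real.logb 2 (D / (meanSq L b * (1 / 12 + η))) := by
    rw [← hαsq, Real.logb_pow]
    push_cast
    ring
  have hdist : distortion a σ S L (fun i => α * b i) ≤ ENNReal.ofReal D := by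
    rw [hSL, distortion_eq hL hαb hLd hn ha]
    refine ENNReal.ofReal_le_ofReal ?_
    calc 1 / (n : ℝ) * ∑ i, (α * b i * L i i) ^ 2 * meanRoundErr σ L (fun i => α * b i) i
        ≤ 1 / (n : ℝ) * ∑ i, (α * b i * L i i) ^ 2 * (1 / 12 + η) := by
          gcongr with i
          linarith [(abs_le.1 (hDround i)).2]
      _ = α ^ 2 * (meanSq L b * (1 / 12 + η)) := by
          rw [meanSq, ← Finset.sum_mul]
          have : ∀ i, (α * b i * L i i) ^ 2 = α ^ 2 * (b i * L i i) ^ 2 := fun i => by ring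
          simp only [this, ← Finset.mul_sum]
          ring
      _ = D := by rw [hαsq]; field_simp
  have herr : ∀ x i, |x i - α * b i * rowIdx L (fun i => α * b i) x i| ≤ α * K := by
    intro x i
    refine (abs_error_le hL (fun i => (hαb i).ne') hLd x i).trans ?_
    have h1 : ∑ k, |α * b k| * |L k k| * |L⁻¹ k i| = α * ∑ k, b k * |L k k| * |L⁻¹ k i| := by
      rw [Finset.mul_sum]
      refine Finset.sum_congr rfl fun k _ => ?_
      rw [abs_of_pos (hαb k)]
      ring
    rw [h1, hK]
    refine mul_le_mul_of_nonneg_left ?_ hα0.le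
    exact Finset.single_le_sum (f := fun i => ∑ k, b k * |L k k| * |L⁻¹ k i|)
      (fun i _ => Finset.sum_nonneg fun k _ =>
        mul_nonneg (mul_nonneg (hb k).le (abs_nonneg _)) (abs_nonneg _)) (Finset.mem_univ i)
  set R : ℝ := 2 / a + (1 / n) * ∑ i, (gaussianEntropy σ - Real.logb 2 (α * b i)
    + rateExcess σ (α * b i) (α * K)) with hR
  have hrate : rateAt a σ S L (fun α i => α * b i) D ≤ ENNReal.ofReal R :=
    (iInf_le_of_le α (iInf_le_of_le hα0 (iInf_le _ hdist))).trans
      (rate_le hL hαb hLd hσ hn ha herr hDent)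
  have hl : 0 < Real.log 2 := Real.log_pos (by norm_num)
  have hK0 : 0 ≤ K := Finset.sum_nonneg fun i _ => Finset.sum_nonneg fun k _ =>
    mul_nonneg (mul_nonneg (hb k).le (abs_nonneg _)) (abs_nonneg _)
  have hR0 : 0 ≤ R := by
    refine add_nonneg (by positivity) (mul_nonneg (by positivity) (Finset.sum_nonneg fun i _ => ?_))
    refine add_nonneg (sub_nonneg.2 (hDent i)) ?_
    unfold rateExcess
    positivity
  have hReq : R = 2 / a + (gaussianEntropy σ - Real.logb 2 α - (1 / n) * ∑ i, Real.logb 2 (b i))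
      + (1 / n) * ∑ i, rateExcess σ (α * b i) (α * K) := by
    rw [hR, Finset.sum_add_distrib, mul_add, sum_gaussianEntropy_sub hn hb hα0]
    ring
  have hVeq := gaussianEntropy_sub_eq hn hσ hb hLd hD0' (t := 1 / 12 + η) (by linarith)
  rw [← hWF, ← hlogα] at hVeq
  have h1 : ((rateAt a σ S L (fun α i => α * b i) D : ℝ≥0∞) : EReal) ≤ (R : EReal) := by
    refine le_trans (EReal.coe_ennreal_le_coe_ennreal_iff.2 hrate) ?_
    rw [EReal.coe_ennreal_ofReal, max_eq_left hR0]
  calc ((rateAt a σ S L (fun α i => α * b i) D : ℝ≥0∞) : EReal)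
        - ((rateWF σ hS.isHermitian D : ℝ) : EReal)
      ≤ (R : EReal) - ((rateWF σ hS.isHermitian D : ℝ) : EReal) := EReal.sub_le_sub h1 le_rfl
    _ = ((R - rateWF σ hS.isHermitian D : ℝ) : EReal) := (EReal.coe_sub _ _).symm
    _ ≤ _ := EReal.coe_le_coe_iff.2 (by linarith)

/-- The high-resolution gap to waterfilling of ZSIC with the spacings `α b_i`. -/
theorem hasIteratedLimit_rateAt_sub (hn : 0 < n) (hσ : 0 < σ) (hS : S.PosDef)
    (hL : ∀ i j : Fin n, i < j → L i j = 0) (hSL : S = L * Lᵀ) (hb : ∀ i, 0 < b i) :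
    HasIteratedLimit (fun a D => ((rateAt a σ S L (fun α i => α * b i) D : ℝ≥0∞) : EReal)
      - ((rateWF σ hS.isHermitian D : ℝ) : EReal)) (rateGap L b : ℝ) :=
  hasIteratedLimit_of_bounds
    (fun _ ha _ hε => eventually_le_rateAt_sub hn hσ hS hL hSL hb ha hε)
    (fun _ ha _ hε => eventually_rateAt_sub_le hn hσ hS hL hSL hb ha hε)

end HighResolution

/-! ### The numerical value of the constant -/

theorem abs_half_logb_sub_lt :
    |(1 / 2) * Real.logb 2 (2 * Real.pi * Real.exp 1 / 12) - 0.255| < 0.0005 := by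
  set x := 2 * Real.pi * Real.exp 1 / 12 with hx
  have hπ1 := Real.pi_gt_d4
  have hπ2 := Real.pi_lt_d4
  have he1 := Real.exp_one_gt_d9
  have he2 := Real.exp_one_lt_d9
  have h1 : 1.4232 < x := by rw [hx]; nlinarith
  have h2 : x < 1.4234 := by rw [hx]; nlinarith
  have hx0 : 0 < x := by linarith
  -- The fractions `28/55 > 0.509` and `24/47 < 0.511` enclose `log₂ x` tightly enough and reduce
  -- the claim to comparing integer powers.
  have h3 : (28 : ℝ) < 55 * Real.logb 2 x := by
    have : Real.logb 2 ((2 : ℝ) ^ (28 : ℕ)) < Real.logb 2 (x ^ (55 : ℕ)) := by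
      refine Real.logb_lt_logb (by norm_num) (by norm_num) ?_
      calc (2 : ℝ) ^ 28 < 1.4232 ^ 55 := by norm_num
        _ < x ^ 55 := by gcongr
    rw [Real.logb_pow, Real.logb_pow, Real.logb_self_eq_one (by norm_num)] at this
    push_cast at this
    linarith
  have h4 : 47 * Real.logb 2 x < 24 := by
    have : Real.logb 2 (x ^ (47 : ℕ)) < Real.logb 2 ((2 : ℝ) ^ (24 : ℕ)) := by
      refine Real.logb_lt_logb (by norm_num) (by positivity) ?_
      calc x ^ 47 < 1.4234 ^ 47 := by gcongr
        _ < (2 : ℝ) ^ 24 := by norm_num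
    rw [Real.logb_pow, Real.logb_pow, Real.logb_self_eq_one (by norm_num)] at this
    push_cast at this
    linarith
  rw [abs_lt]
  constructor <;> linarith

end WeightQuant

end

/-! ### The two schemes as special choices of the weights `b` -/

theorem mainTheorem1 {n : ℕ} (hn : 0 < n) (σ : ℝ≥0) (hσ : 0 < σ)
    (S L : Matrix (Fin n) (Fin n) ℝ) (hS : S.PosDef)
    (hL : ∀ i j : Fin n, i < j → L i j = 0) (hSL : S = L * Lᵀ) :
    WeightQuant.HasIteratedLimit
      (fun a D => ((WeightQuant.rateGPTQ a σ S L D : ℝ≥0∞) : EReal)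
        - ((WeightQuant.rateWF σ hS.isHermitian D : ℝ) : EReal))
      (((1 / 2) * Real.logb 2 (2 * Real.pi * Real.exp 1 / 12)
        + (1 / 2) * Real.logb 2
            (((1 / (n : ℝ)) * ∑ i, L i i ^ 2) / (∏ i, L i i ^ 2) ^ (1 / (n : ℝ))) : ℝ) : EReal) ∧
    WeightQuant.HasIteratedLimit
      (fun a D => ((WeightQuant.rateWaterSIC a σ S L D : ℝ≥0∞) : EReal)
        - ((WeightQuant.rateWF σ hS.isHermitian D : ℝ) : EReal))
      (((1 / 2) * Real.logb 2 (2 * Real.pi * Real.exp 1 / 12) : ℝ) : EReal) ∧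
    |(1 / 2) * Real.logb 2 (2 * Real.pi * Real.exp 1 / 12) - 0.255| < 0.0005 := by
  have hn' : (0 : ℝ) < n := by exact_mod_cast hn
  have hLd := WeightQuant.diag_ne_zero_of_posDef hS hL hSL
  refine ⟨?_, ?_, WeightQuant.abs_half_logb_sub_lt⟩
  · have h := WeightQuant.hasIteratedLimit_rateAt_sub hn hσ hS hL hSL (b := fun _ => 1)
      fun _ => one_pos
    simp only [WeightQuant.rateGap, WeightQuant.meanSq, one_mul, mul_one] at h
    exact h
  · have hdet : 0 < |L.det| := by
      rw [abs_pos, Matrix.det_of_isLowerTriangular L (fun i j h => hL i j h)]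
      exact Finset.prod_ne_zero_iff.2 fun i _ => hLd i
    set d := |L.det| ^ (1 / (n : ℝ)) with hd
    have hd0 : 0 < d := Real.rpow_pos_of_pos hdet _
    have h := WeightQuant.hasIteratedLimit_rateAt_sub hn hσ hS hL hSL (b := fun i => d / |L i i|)
      fun i => div_pos hd0 (abs_pos.2 (hLd i))
    -- All scaled diagonal entries have the same square, so their arithmetic and geometric means
    -- coincide and the second logarithm in `rateGap` is zero.
    have hsq : ∀ i, (d / |L i i| * L i i) ^ 2 = d ^ 2 := fun i => by
      have := hLd i
      rw [mul_pow, div_pow, sq_abs]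
      field_simp
    have hgap : WeightQuant.rateGap L (fun i => d / |L i i|)
        = (1 / 2) * Real.logb 2 (2 * Real.pi * Real.exp 1 / 12) := by
      have h1 : 1 / (n : ℝ) * ∑ _i : Fin n, d ^ 2 = d ^ 2 := by
        simp only [Finset.sum_const, Finset.card_univ, Fintype.card_fin, nsmul_eq_mul]
        field_simp
      have h2 : (∏ _i : Fin n, d ^ 2) ^ (1 / (n : ℝ)) = d ^ 2 := by
        rw [Finset.prod_const, Finset.card_univ, Fintype.card_fin, one_div,
          Real.pow_rpow_inv_natCast (by positivity) hn.ne']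
      simp only [WeightQuant.rateGap, WeightQuant.meanSq, hsq, h1, h2]
      rw [div_self (by positivity)]
      simp
    rw [hgap] at h
    exact h
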